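/- Let $(\Omega,\mathcal F,\mathbb P)$ be a probability space, $T>0$, $\mathbb R_0=\mathbb R\setminus\{0\}$, and let $\upsilon$ be a measure on $\mathbb R_0$ with $\int z^2\,\upsilon(dz)<\infty$. Let $L=(L_t)_{0\le t\le T}$ be a square-integrable Poisson jump process with Lévy measure $\upsilon$: a process with almost surely càdlàg paths, whose jump measure $\mu=\sum_{0<s\le T,\ \Delta L_s\ne 0}\delta_{(s,\Delta L_s)}$ is a Poisson random measure on $[0,T]\times\mathbb R_0$ with intensity $\pi(dz,dt)=\upsilon(dz)\,dt$, and which satisfies, for each $t\in[0,T]$, $$L_t=\int_0^t\!\int_{\mathbb R_0} z\,\tilde N(dz,ds)\quad\text{a.s.},\qquad \tilde N=\mu-\pi .$$ Here the compensated integral $\int\!\int f\,d\tilde N$ of a deterministic function $f$ is the $L^2(\mathbb P)$-limit, as $n\to\infty$, of $\int\!\int_{|z|>1/n} f\,d\mu-\int\!\int_{|z|>1/n} f\,d\pi$. Let $\mathcal F_T$ be the $\mathbb P$-completion of $\sigma(L_s: 0\le s\le T)$, and let $\gamma:\mathbb R_0\to(-1,0)\cup(0,1)$ be given by $\gamma(z)=e^{z}-1$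 for $z<0$ and $\gamma(z)=1-e^{-z}$ for $z>0$. Then for every $h\in C([0,T])$ the function $e^{h\gamma}-1-h\gamma$ is $\pi$-integrable, the compensated integral of $h(t)\gamma(z)$ exists, and the random variable $$Y_h=\exp\Big\{\int_0^T\!\int_{\mathbb R_0} h(t)\gamma(z)\,\tilde N(dz,dt)-\int_0^T\!\int_{\mathbb R_0}\big(e^{h(t)\gamma(z)}-1-h(t)\gamma(z)\big)\,\pi(dz,dt)\Big\}$$ lies in $L^2(\mathcal F_T,\mathbb P)$; moreover, the linear span of $\{Y_h: h\in C([0,T])\}$ is dense in the real space $L^2(\mathcal F_T,\mathbb P)$. -/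

import Mathlib

open MeasureTheory ProbabilityTheory Filter Topology
open scoped ENNReal NNReal

noncomputable section

namespace PoissonJump

/-! ### Poisson random measures -/

/-- The Poisson distribution with mean `m ∈ [0, ∞]`, as a law on `[0, ∞]`;
for `m = ∞` it is the Dirac mass at `∞`. -/
def poissonLaw (m : ℝ≥0∞) : Measure ℝ≥0∞ :=
  if m = ∞ then Measure.dirac ∞
  else (poissonMeasure m.toNNReal).map (fun k : ℕ => (k : ℝ≥0∞))

/-- `N` is a Poisson random measure with intensity measure `π` under `P`: `N(A)` is Poisson
distributed with mean `π(A)`, and the values of `N` on pairwise disjoint sets are independent. -/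
structure IsPoissonRandomMeasure {Ω E : Type*} [MeasurableSpace Ω] [MeasurableSpace E]
    (P : Measure Ω) (N : Ω → Measure E) (π : Measure E) : Prop where
  hasLaw : ∀ A : Set E, MeasurableSet A → HasLaw (fun ω => N ω A) (poissonLaw (π A)) P
  indep : ∀ (n : ℕ) (A : Fin n → Set E), (∀ i, MeasurableSet (A i)) →
    Pairwise (fun i j => Disjoint (A i) (A j)) → iIndepFun (fun i ω => N ω (A i)) P

/-! ### Jumps of càdlàg paths -/

/-- The path `x` is càdlàg on `[0, T]`. -/
structure IsCadlagOn (T : ℝ) (x : ℝ → ℝ) : Prop where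
  rightCont : ∀ t ∈ Set.Ico 0 T, ContinuousWithinAt x (Set.Ioi t) t
  leftLim : ∀ t ∈ Set.Ioc 0 T, ∃ l, Tendsto x (𝓝[<] t) (𝓝 l)

/-- The jump `Δx(t) = x(t) - x(t-)`. -/
def jump (x : ℝ → ℝ) (t : ℝ) : ℝ := x t - Function.leftLim x t

/-- The jump measure of the path `x` on `[0, T]`: the sum of the unit masses at the points
`(t, Δx(t))` with `0 < t ≤ T` and `Δx(t) ≠ 0`. Thus the mass of `B × Λ`, for Borel sets `B` of
times in `[0, T]` and `Λ` of non-zero jump sizes, is the number of `t ∈ B` with `Δx(t) ∈ Λ`. -/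
def jumpMeasure (T : ℝ) (x : ℝ → ℝ) : Measure (ℝ × ℝ) :=
  Measure.sum (fun t : {t : ℝ // t ∈ Set.Ioc 0 T ∧ jump x t ≠ 0} =>
    Measure.dirac ((t : ℝ), jump x t))

/-! ### Lévy measure and compensated integral -/

/-- `υ` is the Lévy measure of a square-integrable jump process: it does not charge `0` and
`∫ z² υ(dz) < ∞`. -/
structure IsSqIntegrableLevyMeasure (υ : Measure ℝ) : Prop where
  zero : υ {0} = 0
  sq : ∫⁻ z, ENNReal.ofReal (z ^ 2) ∂υ < ∞

/-- The compensator `π(dz, dt) = υ(dz) dt` on `[0, T] × ℝ`; points are written `(t, z)`. -/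
def compensator (T : ℝ) (υ : Measure ℝ) : Measure (ℝ × ℝ) :=
  (volume.restrict (Set.Icc 0 T)).prod υ

/-- The integral of `f` against `μ - π` over the jumps of size larger than `1 / (n + 1)`,
where `μ` and `π` are finite and both integrals are ordinary ones. -/
def truncatedIntegral {Ω : Type*} (μ : Ω → Measure (ℝ × ℝ)) (π : Measure (ℝ × ℝ))
    (f : ℝ × ℝ → ℝ) (n : ℕ) (ω : Ω) : ℝ :=
  (∫ p in {p : ℝ × ℝ | 1 / ((n : ℝ) + 1) < |p.2|}, f p ∂(μ ω)) -
    ∫ p in {p : ℝ × ℝ | 1 / ((n : ℝ) + 1) < |p.2|}, f p ∂π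

/-- `I` is (a version of) the compensated integral `∫∫ f(t, z) (μ - π)(dz, dt)` of a deterministic
integrand `f`: the integrals over the jumps of size larger than `1 / (n + 1)` converge to `I` in
`L²(P)`. This determines `I` up to `P`-almost sure equality. -/
structure IsCompensatedIntegral {Ω : Type*} [MeasurableSpace Ω] (P : Measure Ω)
    (μ : Ω → Measure (ℝ × ℝ)) (π : Measure (ℝ × ℝ)) (f : ℝ × ℝ → ℝ) (I : Ω → ℝ) : Prop where
  memLp : MemLp I 2 P
  tendsto : Tendsto (fun n => eLpNorm (fun ω => truncatedIntegral μ π f n ω - I ω) 2 P)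
    atTop (𝓝 0)

/-! ### The jump process `L` -/

/-- `L = (L_t)`, `0 ≤ t ≤ T`, is a square-integrable Poisson jump process with Lévy measure `υ`:
a process with almost surely càdlàg paths whose jump measure `μ` is a Poisson random measure with
intensity `π(dz, dt) = υ(dz) dt`, and `L_t = ∫_0^t ∫ z (μ - π)(dz, ds)` almost surely for
each `t`. -/
structure IsPoissonJumpProcess {Ω : Type*} [MeasurableSpace Ω] (P : Measure Ω)
    (T : ℝ) (υ : Measure ℝ) (L : ℝ → Ω → ℝ) : Prop where
  levyMeasure : IsSqIntegrableLevyMeasure υ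
  measurable : ∀ t ∈ Set.Icc 0 T, Measurable (L t)
  cadlag : ∀ᵐ ω ∂P, IsCadlagOn T (fun t => L t ω)
  poisson : IsPoissonRandomMeasure P (fun ω => jumpMeasure T (fun t => L t ω)) (compensator T υ)
  eq_integral : ∀ t ∈ Set.Icc 0 T,
    IsCompensatedIntegral P (fun ω => jumpMeasure T (fun s => L s ω)) (compensator T υ)
      (fun p => (Set.Icc 0 t).indicator (fun _ => p.2) p.1) (L t)

/-- The `σ`-algebra `σ(L_s : 0 ≤ s ≤ T)`. -/
abbrev sigmaL {Ω : Type*} (T : ℝ) (L : ℝ → Ω → ℝ) : MeasurableSpace Ω :=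
  ⨆ t ∈ Set.Icc 0 T, MeasurableSpace.comap (L t) inferInstance

/-- `L²(F_T, P)` as a subspace of `L²(P)`: the classes of square-integrable random variables which
are almost surely equal to a `σ(L_s : s ≤ T)`-measurable one, i.e. which are measurable with
respect to the `P`-completion `F_T` of `σ(L_s : s ≤ T)`. -/
def L2FT {Ω : Type*} [MeasurableSpace Ω] (P : Measure Ω) (T : ℝ) (L : ℝ → Ω → ℝ) :
    Submodule ℝ (Lp ℝ 2 P) :=
  lpMeas ℝ ℝ (sigmaL T L) 2 P

/-! ### The exponentials -/

/-- The function modifying the jumps: `e^z - 1` for `z < 0` and `1 - e^{-z}` for `z > 0`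
(the value at `0`, which no jump takes, is `0`). -/
def gam (z : ℝ) : ℝ := if z < 0 then Real.exp z - 1 else 1 - Real.exp (-z)

/-- The integrand `e^{h(t)γ(z)} - 1 - h(t)γ(z)`. -/
def expCorrection (h : ℝ → ℝ) (p : ℝ × ℝ) : ℝ :=
  Real.exp (h p.1 * gam p.2) - 1 - h p.1 * gam p.2

/-- `Y = exp { ∫∫ h(t)γ(z) (μ - π)(dz, dt) - ∫∫ (e^{h(t)γ(z)} - 1 - h(t)γ(z)) π(dz, dt) }`
almost surely, where `μ` is the jump measure of `L` and `π(dz, dt) = υ(dz) dt`. -/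
def IsExponential {Ω : Type*} [MeasurableSpace Ω] (P : Measure Ω) (T : ℝ) (υ : Measure ℝ)
    (L : ℝ → Ω → ℝ) (h : ℝ → ℝ) (Y : Ω → ℝ) : Prop :=
  ∃ I : Ω → ℝ,
    IsCompensatedIntegral P (fun ω => jumpMeasure T (fun t => L t ω)) (compensator T υ)
      (fun p => h p.1 * gam p.2) I ∧
    Y =ᵐ[P] fun ω => Real.exp (I ω - ∫ p, expCorrection h p ∂(compensator T υ))

end PoissonJump

end

/-! Everything rests on three facts about the compensated integral.

Isometry. Disjoint sets carry independent Poisson counts, which fixes the second moments of the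
random measure. Hence the compensated integral is a linear isometry from L²(π) to L²(P)
(`IsCompensatedIntegral.eLpNorm_eq`), and dominated convergence of integrands gives L²-convergence
of integrals.

Exponential moments. For simple integrands the Laplace functional is a product of Poisson generating
functions. Fatou's lemma carries it over, as an upper bound, to bounded square-integrable integrands
(`IsCompensatedIntegral.lintegral_exp_le`). Applied to the doubled integrand it puts the
exponentials in L².

Exchange of jump sizes. Cut (s, t] into short intervals and apply a bounded, uniformly continuous Φ
that vanishes near 0 to the increment of the integral of w over each. A short interval rarely holds
two jumps of appreciable size, so the sum converges in L¹ to the sum of Φ(w(z)) over the jumps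
(`exists_integral_abs_sub_le`, `aestronglyMeasurable_slab_comp`). After truncation and a limit, the
integrals of w determine those of G ∘ w. With w the identity and G = γ, the integrals of h(t)γ(z)
are measurable for the completed σ-algebra of L (`aestronglyMeasurable_mul_gam`), so the closed span
lies in `L2FT`. With w = γ and G = γ⁻¹, they in turn determine every L_t
(`aestronglyMeasurable_of_mul_gam`).

For density, let X in `L2FT` be orthogonal to all exponentials. A linear combination of the
integrals of h(t)γ(z) is again such an integral, so X is orthogonal to the exponentials of all
finite combinations. The finite measures X⁺P and X⁻P thus have equal Laplace transforms on all
finite families of these integrals, and so agree on the σ-algebra these generate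
(`setIntegral_eq_zero_of_forall_integral_mul_exp_eq_zero`). Up to null sets that σ-algebra contains
the one generated by L, and X = 0. -/

namespace PoissonJump

/-! ### Moments of the Poisson law -/

lemma lintegral_poissonMeasure (r : ℝ≥0) (g : ℕ → ℝ≥0∞) :
    ∫⁻ k, g k ∂(poissonMeasure r) =
      ∑' n : ℕ, ENNReal.ofReal (Real.exp (-r) * r ^ n / n.factorial) * g n := by
  rw [poissonMeasure, lintegral_sum_measure]
  simp

/-- The Poisson weights satisfy (n + 1) p(n + 1) = r p(n), so a factor k shifts the index by one.
Both moments below follow from this. -/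
lemma lintegral_mul_poissonMeasure (r : ℝ≥0) (g : ℕ → ℝ≥0∞) :
    ∫⁻ k, k * g k ∂(poissonMeasure r) = r * ∫⁻ k, g (k + 1) ∂(poissonMeasure r) := by
  rw [lintegral_poissonMeasure, lintegral_poissonMeasure, tsum_eq_zero_add' ENNReal.summable,
    ← ENNReal.tsum_mul_left]
  simp only [Nat.cast_zero, zero_mul, mul_zero, zero_add]
  congr 1 with n
  rw [← mul_assoc, ← mul_assoc]
  congr 1
  have hr : (r : ℝ≥0∞) = ENNReal.ofReal r := by simp
  have hn : ((n + 1 : ℕ) : ℝ≥0∞) = ENNReal.ofReal ((n + 1 : ℕ) : ℝ) := by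
    rw [ENNReal.ofReal_natCast]
  rw [hr, hn, ← ENNReal.ofReal_mul (by positivity), ← ENNReal.ofReal_mul (by positivity)]
  congr 1
  rw [Nat.factorial_succ]
  push_cast
  have : (n.factorial : ℝ) ≠ 0 := by positivity
  have : (n : ℝ) + 1 ≠ 0 := by positivity
  field_simp
  ring

lemma lintegral_natCast_poissonMeasure (r : ℝ≥0) :
    ∫⁻ k, (k : ℝ≥0∞) ∂(poissonMeasure r) = r := by
  simpa using lintegral_mul_poissonMeasure r (fun _ => 1)

lemma lintegral_natCast_sq_poissonMeasure (r : ℝ≥0) :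
    ∫⁻ k, (k : ℝ≥0∞) ^ 2 ∂(poissonMeasure r) = (r : ℝ≥0∞) ^ 2 + r := by
  have := lintegral_mul_poissonMeasure r (fun k => (k : ℝ≥0∞))
  simp only [← sq] at this
  rw [this]
  push_cast
  rw [lintegral_add_right _ measurable_const, lintegral_natCast_poissonMeasure]
  simp; ring

lemma lintegral_id_poissonLaw (m : ℝ≥0∞) : ∫⁻ x, x ∂(poissonLaw m) = m := by
  unfold poissonLaw
  split_ifs with hm
  · simp [hm]
  · rw [lintegral_map (f := fun x => x) measurable_id .of_discrete,
      lintegral_natCast_poissonMeasure,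
      ENNReal.coe_toNNReal hm]

lemma lintegral_sq_poissonLaw (m : ℝ≥0∞) : ∫⁻ x, x ^ 2 ∂(poissonLaw m) = m ^ 2 + m := by
  unfold poissonLaw
  split_ifs with hm
  · simp [hm]
  · rw [lintegral_map (by fun_prop) .of_discrete, lintegral_natCast_sq_poissonMeasure,
      ENNReal.coe_toNNReal hm]

lemma ae_exists_natCast_poissonLaw {m : ℝ≥0∞} (hm : m ≠ ∞) :
    ∀ᵐ x : ℝ≥0∞ ∂(poissonLaw m), ∃ k : ℕ, x = (k : ℝ≥0∞) := by
  unfold poissonLaw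
  rw [if_neg hm]
  have hs : MeasurableSet {x : ℝ≥0∞ | ∃ k : ℕ, x = k} := by
    have : {x : ℝ≥0∞ | ∃ k : ℕ, x = k} = Set.range (fun k : ℕ => (k : ℝ≥0∞)) := by
      ext x; simp [eq_comm]
    rw [this]
    exact (Set.countable_range _).measurableSet
  have hf : Measurable (fun k : ℕ => (k : ℝ≥0∞)) := .of_discrete
  rw [ae_map_iff hf.aemeasurable hs]
  filter_upwards with k using ⟨k, rfl⟩

lemma mgf_toReal_poissonLaw {m : ℝ≥0∞} (hm : m ≠ ∞) (t : ℝ) :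
    mgf ENNReal.toReal (poissonLaw m) t = Real.exp ((Real.exp t - 1) * m.toReal) := by
  unfold mgf poissonLaw
  rw [if_neg hm, integral_map Measurable.of_discrete.aemeasurable
    (Measurable.aestronglyMeasurable (by fun_prop)), integral_poissonMeasure]
  have h := (NormedSpace.expSeries_div_hasSum_exp (m.toReal * Real.exp t)).mul_left
    (Real.exp (-m.toReal))
  rw [← Real.exp_eq_exp_ℝ, ← Real.exp_add] at h
  have e : (Real.exp t - 1) * m.toReal = -m.toReal + m.toReal * Real.exp t := by ring
  rw [e, ← h.tsum_eq]
  congr 1 with n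
  simp only [ENNReal.toReal_natCast, smul_eq_mul, ENNReal.coe_toNNReal_eq_toReal, mul_pow,
    ← Real.exp_nat_mul]
  rw [mul_comm t]
  ring

/-! ### First and second moments of a Poisson random measure -/

namespace IsPoissonRandomMeasure

variable {Ω E : Type*} [MeasurableSpace Ω] [MeasurableSpace E] {P : Measure Ω}
  {N : Ω → Measure E} {π : Measure E}

lemma aemeasurable_apply (h : IsPoissonRandomMeasure P N π) {A : Set E} (hA : MeasurableSet A) :
    AEMeasurable (fun ω => N ω A) P := (h.hasLaw A hA).aemeasurable

lemma lintegral_apply (h : IsPoissonRandomMeasure P N π) {A : Set E} (hA : MeasurableSet A) :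
    ∫⁻ ω, N ω A ∂P = π A := by
  rw [(h.hasLaw A hA).lintegral_comp (f := fun x => x) aemeasurable_id', lintegral_id_poissonLaw]

lemma lintegral_apply_sq (h : IsPoissonRandomMeasure P N π) {A : Set E} (hA : MeasurableSet A) :
    ∫⁻ ω, N ω A * N ω A ∂P = π A * π A + π A := by
  simp only [← sq]
  rw [(h.hasLaw A hA).lintegral_comp (f := fun x => x ^ 2) (by fun_prop),
    lintegral_sq_poissonLaw]

lemma lintegral_apply_mul_of_disjoint (h : IsPoissonRandomMeasure P N π) {A B : Set E}
    (hA : MeasurableSet A) (hB : MeasurableSet B) (hAB : Disjoint A B) :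
    ∫⁻ ω, N ω A * N ω B ∂P = π A * π B := by
  have hi := h.indep 2 ![A, B] (by intro i; fin_cases i <;> simpa)
    (by intro i j hij; fin_cases i <;> fin_cases j <;> simp_all [disjoint_comm])
  have := hi.indepFun (i := 0) (j := 1) (by simp)
  simp only [Matrix.cons_val_zero, Matrix.cons_val_one] at this
  rw [← h.lintegral_apply hA, ← h.lintegral_apply hB]
  exact lintegral_mul_eq_lintegral_mul_lintegral_of_indepFun'' (h.aemeasurable_apply hA)
    (h.aemeasurable_apply hB) this

/-- Split A and B along A ∩ B. Only the common part is correlated with itself, and its variance is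
the extra term. In `ℝ≥0∞` infinite masses need no separate treatment. -/
lemma lintegral_apply_mul (h : IsPoissonRandomMeasure P N π) {A B : Set E}
    (hA : MeasurableSet A) (hB : MeasurableSet B) :
    ∫⁻ ω, N ω A * N ω B ∂P = π A * π B + π (A ∩ B) := by
  have mC := hA.inter hB
  have mD := hA.diff hB
  have mD' := hB.diff hA
  have eA (μ : Measure E) : μ A = μ (A ∩ B) + μ (A \ B) := (measure_inter_add_sdiff A hB).symm
  have eB (μ : Measure E) : μ B = μ (A ∩ B) + μ (B \ A) := by
    rw [Set.inter_comm]; exact (measure_inter_add_sdiff B hA).symm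
  have d1 : Disjoint (A ∩ B) (B \ A) := Set.disjoint_left.2 fun x hx hx' => hx'.2 hx.1
  have d2 : Disjoint (A \ B) (A ∩ B) := Set.disjoint_left.2 fun x hx hx' => hx.2 hx'.2
  have d3 : Disjoint (A \ B) (B \ A) := Set.disjoint_left.2 fun x hx hx' => hx.2 hx'.1
  have hm {S U : Set E} (hS : MeasurableSet S) (hU : MeasurableSet U) :
      AEMeasurable (fun ω => N ω S * N ω U) P :=
    (h.aemeasurable_apply hS).mul (h.aemeasurable_apply hU)
  calc ∫⁻ ω, N ω A * N ω B ∂P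
      = ∫⁻ ω, (N ω (A ∩ B) * N ω (A ∩ B) + N ω (A ∩ B) * N ω (B \ A)) +
          (N ω (A \ B) * N ω (A ∩ B) + N ω (A \ B) * N ω (B \ A)) ∂P := by
        congr 1 with ω
        rw [eA (N ω), eB (N ω)]; ring
    _ = _ := by
        rw [lintegral_add_left' (by exact (hm mC mC).add (hm mC mD')), lintegral_add_left' (hm mC mC),
          lintegral_add_left' (hm mD mC), h.lintegral_apply_sq mC,
          h.lintegral_apply_mul_of_disjoint mC mD' d1, h.lintegral_apply_mul_of_disjoint mD mC d2,
          h.lintegral_apply_mul_of_disjoint mD mD' d3, eA π, eB π]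
        ring

/-- `N` is not known to be a measurable map into measures: only the counts `N ω A` are a.e.
measurable, so the statement is built up from indicators. -/
lemma aemeasurable_lintegral (h : IsPoissonRandomMeasure P N π) {f : E → ℝ≥0∞}
    (hf : Measurable f) : AEMeasurable (fun ω => ∫⁻ x, f x ∂(N ω)) P := by
  refine Measurable.ennreal_induction ?_ ?_ ?_ hf
  · intro c s hs
    simp only [lintegral_indicator_const hs]
    exact (h.aemeasurable_apply hs).const_mul c
  · intro f g _ hf hg ihf ihg
    simp only [Pi.add_apply, lintegral_add_left hf]
    exact ihf.add ihg
  · intro f hf hmono ih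
    simp only [lintegral_iSup hf hmono]
    exact AEMeasurable.iSup ih

lemma lintegral_lintegral (h : IsPoissonRandomMeasure P N π) {f : E → ℝ≥0∞}
    (hf : Measurable f) : ∫⁻ ω, ∫⁻ x, f x ∂(N ω) ∂P = ∫⁻ x, f x ∂π := by
  refine Measurable.ennreal_induction ?_ ?_ ?_ hf
  · intro c s hs
    simp only [lintegral_indicator_const hs]
    rw [lintegral_const_mul'' _ (h.aemeasurable_apply hs), h.lintegral_apply hs]
  · intro f g _ hf hg ihf ihg
    simp only [Pi.add_apply, lintegral_add_left hf]
    rw [lintegral_add_left' (h.aemeasurable_lintegral hf), ihf, ihg]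
  · intro f hf hmono ih
    simp only [lintegral_iSup hf hmono]
    rw [lintegral_iSup' (fun n => h.aemeasurable_lintegral (hf n))
      (ae_of_all _ fun ω i j hij => lintegral_mono (hmono hij))]
    simp only [ih]

lemma lintegral_apply_mul_lintegral (h : IsPoissonRandomMeasure P N π) {A : Set E}
    (hA : MeasurableSet A) {f : E → ℝ≥0∞} (hf : Measurable f) :
    ∫⁻ ω, N ω A * ∫⁻ x, f x ∂(N ω) ∂P = π A * ∫⁻ x, f x ∂π + ∫⁻ x in A, f x ∂π := by
  have mA := h.aemeasurable_apply hA
  refine Measurable.ennreal_induction ?_ ?_ ?_ hf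
  · intro c s hs
    simp only [lintegral_indicator_const hs, mul_left_comm _ c]
    rw [lintegral_const_mul'' _ (by exact mA.mul (h.aemeasurable_apply hs)),
      h.lintegral_apply_mul hA hs, mul_add, Measure.restrict_apply hs, Set.inter_comm]
  · intro f g _ hf hg ihf ihg
    simp only [Pi.add_apply, lintegral_add_left hf, mul_add]
    rw [lintegral_add_left' (by exact mA.mul (h.aemeasurable_lintegral hf)), ihf, ihg]
    ring
  · intro f hf hmono ih
    simp only [lintegral_iSup hf hmono, ENNReal.mul_iSup]
    rw [lintegral_iSup' (f := fun n ω => N ω A * ∫⁻ x, f n x ∂(N ω))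
      (fun n => mA.mul (h.aemeasurable_lintegral (hf n)))
      (ae_of_all _ fun ω i j hij => mul_le_mul_right (lintegral_mono (hmono hij)) _)]
    simp only [ih]
    rw [ENNReal.iSup_add_iSup_of_monotone]
    · exact fun i j hij => mul_le_mul_right (lintegral_mono (hmono hij)) _
    · exact fun i j hij => lintegral_mono (hmono hij)

/-- Both sides are bilinear and continuous along increasing sequences, so the formula for sets
extends one argument at a time. -/
lemma lintegral_lintegral_mul_lintegral (h : IsPoissonRandomMeasure P N π) {f g : E → ℝ≥0∞}
    (hf : Measurable f) (hg : Measurable g) :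
    ∫⁻ ω, (∫⁻ x, g x ∂(N ω)) * ∫⁻ x, f x ∂(N ω) ∂P =
      (∫⁻ x, g x ∂π) * ∫⁻ x, f x ∂π + ∫⁻ x, g x * f x ∂π := by
  have mf := h.aemeasurable_lintegral hf
  refine Measurable.ennreal_induction ?_ ?_ ?_ hg
  · intro c s hs
    simp only [lintegral_indicator_const hs, mul_assoc]
    rw [lintegral_const_mul'' _ (by exact (h.aemeasurable_apply hs).mul mf),
      h.lintegral_apply_mul_lintegral hs hf, mul_add]
    congr 1
    rw [← lintegral_indicator hs, ← lintegral_const_mul _ (hf.indicator hs)]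
    congr 1 with x
    by_cases hx : x ∈ s <;> simp [hx]
  · intro g g' _ hg hg' ihf ihg
    simp only [Pi.add_apply, lintegral_add_left hg, add_mul]
    rw [lintegral_add_left' (by exact (h.aemeasurable_lintegral hg).mul mf), ihf, ihg,
      lintegral_add_left (by exact hg.mul hf)]
    ring
  · intro g hg hmono ih
    simp only [lintegral_iSup hg hmono, ENNReal.iSup_mul]
    rw [lintegral_iSup' (f := fun n ω => (∫⁻ x, g n x ∂(N ω)) * ∫⁻ x, f x ∂(N ω))
      (fun n => (h.aemeasurable_lintegral (hg n)).mul mf)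
      (ae_of_all _ fun ω i j hij => mul_le_mul_left (lintegral_mono (hmono hij)) _)]
    simp only [ih]
    rw [← ENNReal.iSup_add_iSup_of_monotone]
    · congr 1
      rw [lintegral_iSup (f := fun n x => g n x * f x) (fun n => (hg n).mul hf)]
      exact fun i j hij x => mul_le_mul_left (hmono hij x) _
    · exact fun i j hij => mul_le_mul_left (lintegral_mono (hmono hij)) _
    · exact fun i j hij => lintegral_mono fun x => mul_le_mul_left (hmono hij x) _

end IsPoissonRandomMeasure

/-- The compensated integral `∫ f dN - ∫ f dπ` of an integrable function. -/
noncomputable def compInt {Ω E : Type*} [MeasurableSpace E] (N : Ω → Measure E) (π : Measure E)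
    (f : E → ℝ) (ω : Ω) : ℝ :=
  (∫ x, f x ∂(N ω)) - ∫ x, f x ∂π

namespace IsPoissonRandomMeasure

variable {Ω E : Type*} [MeasurableSpace Ω] [MeasurableSpace E] {P : Measure Ω}
  {N : Ω → Measure E} {π : Measure E}

/-- A π-null set has expected mass zero, hence almost surely mass zero. This permits replacing
integrands by measurable versions. -/
lemma ae_ae_eq (h : IsPoissonRandomMeasure P N π) {β : Type*} {f g : E → β} (hfg : f =ᵐ[π] g) :
    ∀ᵐ ω ∂P, f =ᵐ[N ω] g := by
  have h0 : π (toMeasurable π {x | f x ≠ g x}) = 0 := by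
    rw [measure_toMeasurable]; exact hfg
  have hm := measurableSet_toMeasurable π {x | f x ≠ g x}
  rw [← h.lintegral_apply hm, lintegral_eq_zero_iff' (h.aemeasurable_apply hm)] at h0
  filter_upwards [h0] with ω hω
  exact measure_mono_null (subset_toMeasurable π _) hω

lemma ae_integrable (h : IsPoissonRandomMeasure P N π) {f : E → ℝ} (hf : Integrable f π) :
    ∀ᵐ ω ∂P, Integrable f (N ω) := by
  have hm := hf.1.stronglyMeasurable_mk.measurable
  have hf' := hf.congr hf.1.ae_eq_mk
  have hlt : ∫⁻ ω, ∫⁻ x, ‖hf.1.mk f x‖ₑ ∂(N ω) ∂P ≠ ∞ := by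
    rw [h.lintegral_lintegral hm.enorm]; exact hf'.2.ne
  filter_upwards [h.ae_ae_eq hf.1.ae_eq_mk,
    ae_lt_top' (h.aemeasurable_lintegral hm.enorm) hlt] with ω h1 h2
  exact Integrable.congr ⟨hm.aestronglyMeasurable, h2⟩ h1.symm

lemma compInt_congr (h : IsPoissonRandomMeasure P N π) {f g : E → ℝ} (hfg : f =ᵐ[π] g) :
    compInt N π f =ᵐ[P] compInt N π g := by
  filter_upwards [h.ae_ae_eq hfg] with ω hω
  rw [compInt, compInt, integral_congr_ae hω, integral_congr_ae hfg]

lemma compInt_sub (h : IsPoissonRandomMeasure P N π) {f g : E → ℝ} (hf : Integrable f π)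
    (hg : Integrable g π) :
    compInt N π (fun x => f x - g x) =ᵐ[P] fun ω => compInt N π f ω - compInt N π g ω := by
  filter_upwards [h.ae_integrable hf, h.ae_integrable hg] with ω h1 h2
  simp only [compInt]
  rw [integral_sub h1 h2, integral_sub hf hg]
  ring

lemma compInt_add (h : IsPoissonRandomMeasure P N π) {f g : E → ℝ} (hf : Integrable f π)
    (hg : Integrable g π) :
    compInt N π (fun x => f x + g x) =ᵐ[P] fun ω => compInt N π f ω + compInt N π g ω := by
  filter_upwards [h.ae_integrable hf, h.ae_integrable hg] with ω h1 h2
  simp only [compInt]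
  rw [integral_add h1 h2, integral_add hf hg]
  ring

omit [MeasurableSpace Ω] in
lemma compInt_const_mul (c : ℝ) (f : E → ℝ) (ω : Ω) :
    compInt N π (fun x => c * f x) ω = c * compInt N π f ω := by
  simp only [compInt, integral_const_mul]
  ring

lemma aemeasurable_integral (h : IsPoissonRandomMeasure P N π) {f : E → ℝ} (hf : Integrable f π) :
    AEMeasurable (fun ω => ∫ x, f x ∂(N ω)) P := by
  have hm := hf.1.stronglyMeasurable_mk.measurable
  have m1 := (h.aemeasurable_lintegral hm.ennreal_ofReal).ennreal_toReal
  have m2 := (h.aemeasurable_lintegral hm.neg.ennreal_ofReal).ennreal_toReal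
  refine (m1.sub m2).congr ?_
  filter_upwards [h.ae_ae_eq hf.1.ae_eq_mk, h.ae_integrable hf] with ω h1 h2
  rw [integral_congr_ae h1,
    integral_eq_lintegral_pos_part_sub_lintegral_neg_part (h2.congr h1)]
  rfl

lemma aestronglyMeasurable_compInt (h : IsPoissonRandomMeasure P N π) {f : E → ℝ}
    (hf : Integrable f π) : AEStronglyMeasurable (compInt N π f) P :=
  ((h.aemeasurable_integral hf).sub_const _).aestronglyMeasurable

/-- The isometry for the compensated integral of a measurable function. -/
lemma memLp_compInt_of_measurable [IsProbabilityMeasure P] (h : IsPoissonRandomMeasure P N π)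
    {f : E → ℝ} (hm : Measurable f) (hf : Integrable f π) (hf2 : MemLp f 2 π) :
    MemLp (compInt N π f) 2 P ∧ ∫ ω, compInt N π f ω ^ 2 ∂P = ∫ x, f x ^ 2 ∂π := by
  set u : E → ℝ≥0∞ := fun x => ENNReal.ofReal (f x) with hu
  set v : E → ℝ≥0∞ := fun x => ENNReal.ofReal (-f x) with hv
  have mu : Measurable u := hm.ennreal_ofReal
  have mv : Measurable v := hm.neg.ennreal_ofReal
  set A : Ω → ℝ≥0∞ := fun ω => ∫⁻ x, u x ∂(N ω) with hA
  set B : Ω → ℝ≥0∞ := fun ω => ∫⁻ x, v x ∂(N ω) with hB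
  have mA : AEMeasurable A P := h.aemeasurable_lintegral mu
  have mB : AEMeasurable B P := h.aemeasurable_lintegral mv
  set α := ∫⁻ x, u x ∂π with hα
  set β := ∫⁻ x, v x ∂π with hβ
  have fα : α ≠ ∞ := hf.lintegral_lt_top.ne
  have fβ : β ≠ ∞ := hf.neg.lintegral_lt_top.ne
  have hsq := hf2.integrable_sq
  have uv (x) : v x * u x = 0 := by
    rcases le_total (f x) 0 with hx | hx <;> simp [hu, hv, hx]
  have uu (x) : u x * u x + v x * v x = ENNReal.ofReal (f x ^ 2) := by
    rcases le_total (f x) 0 with hx | hx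
    · simp only [hu, hv, ENNReal.ofReal_of_nonpos hx, zero_mul, zero_add]
      rw [← ENNReal.ofReal_mul (by linarith)]; congr 1; ring
    · simp only [hu, hv, ENNReal.ofReal_of_nonpos (neg_nonpos.2 hx), zero_mul, add_zero]
      rw [← ENNReal.ofReal_mul hx]; congr 1; ring
  set p := ∫⁻ x, u x * u x ∂π with hp
  set q := ∫⁻ x, v x * v x ∂π with hq
  have hpq : p + q = ∫⁻ x, ENNReal.ofReal (f x ^ 2) ∂π := by
    rw [hp, hq, ← lintegral_add_left (by exact mu.mul mu)]
    simp only [uu]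
  have fpq : p + q ≠ ∞ := hpq ▸ hsq.lintegral_lt_top.ne
  have fp : p ≠ ∞ := fun h0 => fpq (by simp [h0])
  have fq : q ≠ ∞ := fun h0 => fpq (by simp [h0])
  have EA : ∫⁻ ω, A ω ∂P = α := h.lintegral_lintegral mu
  have EB : ∫⁻ ω, B ω ∂P = β := h.lintegral_lintegral mv
  have EAA : ∫⁻ ω, A ω * A ω ∂P = α * α + p := h.lintegral_lintegral_mul_lintegral mu mu
  have EBB : ∫⁻ ω, B ω * B ω ∂P = β * β + q := h.lintegral_lintegral_mul_lintegral mv mv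
  -- The positive and negative parts of f have product zero, so their integrals are uncorrelated.
  have EBA : ∫⁻ ω, B ω * A ω ∂P = β * α := by
    rw [h.lintegral_lintegral_mul_lintegral mu mv]; simp [uv, hα, hβ]
  have aA : ∀ᵐ ω ∂P, A ω < ∞ := ae_lt_top' mA (EA ▸ fα)
  have aB : ∀ᵐ ω ∂P, B ω < ∞ := ae_lt_top' mB (EB ▸ fβ)
  have real {X : Ω → ℝ≥0∞} (mX : AEMeasurable X P) {c : ℝ≥0∞} (hc : c ≠ ∞)
      (hX : ∫⁻ ω, X ω ∂P = c) :
      Integrable (fun ω => (X ω).toReal) P ∧ ∫ ω, (X ω).toReal ∂P = c.toReal := by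
    refine ⟨integrable_toReal_of_lintegral_ne_top mX (hX ▸ hc), ?_⟩
    rw [integral_toReal mX (ae_lt_top' mX (hX ▸ hc)), hX]
  obtain ⟨iA, eA⟩ := real mA fα EA
  obtain ⟨iB, eB⟩ := real mB fβ EB
  obtain ⟨iAA, eAA⟩ := real (mA.mul mA) (by finiteness) EAA
  obtain ⟨iBB, eBB⟩ := real (mB.mul mB) (by finiteness) EBB
  obtain ⟨iBA, eBA⟩ := real (mB.mul mA) (by finiteness) EBA
  simp only [Pi.mul_apply, ENNReal.toReal_mul] at iAA eAA iBB eBB iBA eBA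
  rw [ENNReal.toReal_add (by finiteness) fp, ENNReal.toReal_mul] at eAA
  rw [ENNReal.toReal_add (by finiteness) fq, ENNReal.toReal_mul] at eBB
  have hX : compInt N π f =ᵐ[P]
      fun ω => (A ω).toReal - (B ω).toReal - (α.toReal - β.toReal) := by
    filter_upwards [h.ae_integrable hf] with ω hω
    rw [compInt, integral_eq_lintegral_pos_part_sub_lintegral_neg_part hω,
      integral_eq_lintegral_pos_part_sub_lintegral_neg_part hf]
  have hX2 : (fun ω => compInt N π f ω ^ 2) =ᵐ[P] fun ω =>
      ((A ω).toReal * (A ω).toReal + (B ω).toReal * (B ω).toReal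
        - 2 * ((B ω).toReal * (A ω).toReal)
        - (2 * (α.toReal - β.toReal)) * ((A ω).toReal - (B ω).toReal))
        + (α.toReal - β.toReal) ^ 2 := by
    filter_upwards [hX] with ω hω
    rw [hω]; ring
  have i1 := iAA.add iBB
  have i2 := i1.sub (iBA.const_mul 2)
  have i3 := i2.sub ((iA.sub iB).const_mul (2 * (α.toReal - β.toReal)))
  have i4 := i3.add (integrable_const ((α.toReal - β.toReal) ^ 2))
  refine ⟨(memLp_two_iff_integrable_sq (h.aestronglyMeasurable_compInt hf)).2
    (i4.congr hX2.symm), ?_⟩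
  rw [integral_congr_ae hX2, integral_add (by exact i3) (integrable_const _),
    integral_sub (by exact i2) (by exact (iA.sub iB).const_mul _),
    integral_sub (by exact i1) (by exact iBA.const_mul 2),
    integral_add iAA iBB, integral_const_mul, integral_const_mul, integral_sub iA iB, eA, eB, eAA,
    eBB, eBA, integral_const]
  rw [integral_eq_lintegral_of_nonneg_ae (ae_of_all _ fun x => sq_nonneg _) hsq.1, ← hpq,
    ENNReal.toReal_add fp fq]
  simp
  ring

lemma memLp_compInt [IsProbabilityMeasure P] (h : IsPoissonRandomMeasure P N π)
    {f : E → ℝ} (hf : Integrable f π) (hf2 : MemLp f 2 π) : MemLp (compInt N π f) 2 P :=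
  (memLp_congr_ae (h.compInt_congr hf.1.ae_eq_mk)).2
    (h.memLp_compInt_of_measurable hf.1.stronglyMeasurable_mk.measurable
      (hf.congr hf.1.ae_eq_mk) ((memLp_congr_ae hf.1.ae_eq_mk).1 hf2)).1

lemma eLpNorm_compInt [IsProbabilityMeasure P] (h : IsPoissonRandomMeasure P N π)
    {f : E → ℝ} (hf : Integrable f π) (hf2 : MemLp f 2 π) :
    eLpNorm (compInt N π f) 2 P = eLpNorm f 2 π := by
  rw [eLpNorm_congr_ae (h.compInt_congr hf.1.ae_eq_mk), eLpNorm_congr_ae hf.1.ae_eq_mk]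
  have hf2' := (memLp_congr_ae hf.1.ae_eq_mk).1 hf2
  obtain ⟨h1, h2⟩ := h.memLp_compInt_of_measurable hf.1.stronglyMeasurable_mk.measurable
      (hf.congr hf.1.ae_eq_mk) hf2'
  rw [h1.eLpNorm_eq_integral_rpow_norm (by simp) (by simp),
    hf2'.eLpNorm_eq_integral_rpow_norm (by simp) (by simp)]
  simp [h2]

/-! ### Exponential moments -/

lemma iIndepFun_apply (h : IsPoissonRandomMeasure P N π) {ι : Type*} [Fintype ι] {A : ι → Set E}
    (hA : ∀ i, MeasurableSet (A i)) (hd : Pairwise fun i j => Disjoint (A i) (A j)) :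
    iIndepFun (fun i ω => N ω (A i)) P := by
  have e := Fintype.equivFin ι
  have := (h.indep _ (fun k => A (e.symm k)) (fun _ => hA _)
    (fun i j hij => hd (e.symm.injective.ne hij))).precomp e.injective
  simpa using this

lemma mgf_apply (h : IsPoissonRandomMeasure P N π) {A : Set E} (hA : MeasurableSet A)
    (hfin : π A ≠ ∞) (t : ℝ) :
    mgf (fun ω => (N ω A).toReal) P t = Real.exp ((Real.exp t - 1) * (π A).toReal) := by
  rw [← mgf_toReal_poissonLaw hfin, mgf, mgf]
  exact (h.hasLaw A hA).integral_comp (f := fun x => Real.exp (t * x.toReal))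
    (Measurable.aestronglyMeasurable (by fun_prop))

/-- The integral of a simple function is a finite linear combination of independent Poisson counts,
so its moment generating function is a product. -/
lemma lintegral_exp_integral_simpleFunc (h : IsPoissonRandomMeasure P N π) (s : SimpleFunc E ℝ)
    (hs : Integrable s π) :
    ∫⁻ ω, ENNReal.ofReal (Real.exp (∫ x, s x ∂(N ω))) ∂P =
      ENNReal.ofReal (Real.exp (∫ x, (Real.exp (s x) - 1) ∂π)) := by
  classical
  -- The value 0 is left out: its fibre may have infinite mass and contributes nothing.
  set R := s.range.filter (· ≠ 0) with hR
  have hπ (x : R) : π (s ⁻¹' {(x : ℝ)}) ≠ ∞ :=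
    (SimpleFunc.integrable_iff.1 hs x (Finset.mem_filter.1 x.2).2).ne
  have hmeas (x : R) : MeasurableSet (s ⁻¹' {(x : ℝ)}) := s.measurableSet_fiber _
  have hind := h.iIndepFun_apply hmeas (fun x y hxy => by
    refine Disjoint.preimage _ (Set.disjoint_singleton.2 fun e => hxy (Subtype.ext e)))
  have hind' := hind.comp (fun (x : R) (y : ℝ≥0∞) => (x : ℝ) * y.toReal)
    (fun x => by fun_prop)
  have hprob : IsProbabilityMeasure P := hind.isProbabilityMeasure
  have hsum := hind'.mgf_sum₀ (t := 1)
    (fun x => (h.aemeasurable_apply (hmeas x)).ennreal_toReal.const_mul _) Finset.univ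
  have hprod : mgf (∑ x : R, (fun y : ℝ≥0∞ => (x : ℝ) * y.toReal) ∘ fun ω => N ω (s ⁻¹' {(x : ℝ)}))
      P 1 = Real.exp (∫ x, (Real.exp (s x) - 1) ∂π) := by
    rw [hsum]
    have : ∫ x, (Real.exp (s x) - 1) ∂π = ∑ x : R, (Real.exp x - 1) * (π (s ⁻¹' {(x : ℝ)})).toReal := by
      have e1 : ∀ x, Real.exp (s x) - 1 = (s.map fun y => Real.exp y - 1) x := fun x => rfl
      have hint : Integrable (s.map fun y => Real.exp y - 1) π := by
        rw [SimpleFunc.integrable_iff_finMeasSupp] at hs ⊢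
        exact hs.map (by simp)
      simp only [e1]
      rw [← SimpleFunc.integral_eq_integral _ hint, SimpleFunc.map_integral s _ hs (by simp),
        Finset.sum_coe_sort R (fun x => (Real.exp x - 1) * (π (s ⁻¹' {(x : ℝ)})).toReal), hR,
        Finset.sum_filter_of_ne]
      · simp [Measure.real, mul_comm]
      · rintro x - hx rfl
        simp at hx
    rw [this, Real.exp_sum]
    refine Finset.prod_congr rfl fun x _ => ?_
    rw [← h.mgf_apply (hmeas x) (hπ x)]
    simp [mgf]
  rw [← hprod, mgf, ofReal_integral_eq_lintegral_ofReal]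
  · refine lintegral_congr_ae ?_
    filter_upwards [h.ae_integrable hs] with ω hω
    rw [← SimpleFunc.integral_eq_integral _ hω,
      SimpleFunc.integral_eq_sum_filter, ← hR, one_mul, Finset.sum_apply,
      ← Finset.sum_coe_sort R]
    simp [Measure.real, mul_comm]
  -- Without integrability the `mgf` would take its default value 0, but it was just shown to be an
  -- exponential.
  · by_contra hcon
    exact (Real.exp_pos _).ne' (hprod.symm.trans (mgf_undef hcon))
  · exact ae_of_all _ fun ω => (Real.exp_pos _).le

lemma _root_.Real.abs_exp_sub_one_le_mul_exp_abs (x : ℝ) :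
    |Real.exp x - 1| ≤ |x| * Real.exp |x| := by
  have h1 := Real.add_one_le_exp x
  have h2 := Real.add_one_le_exp (-x)
  have h3 : Real.exp (-x) * Real.exp x = 1 := by rw [← Real.exp_add]; simp
  have h4 := Real.exp_pos x
  rcases le_total 0 x with hx | hx
  · rw [abs_of_nonneg hx, abs_le]
    constructor <;> nlinarith
  · rw [abs_of_nonpos hx, abs_le]
    have h5 : 1 ≤ Real.exp (-x) := Real.one_le_exp (by linarith)
    constructor <;> nlinarith

/-- Approximate by simple functions and use Fatou's lemma on the left. Equality is not needed, since
only finiteness of exponential moments is used later. -/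
lemma lintegral_exp_integral_le (h : IsPoissonRandomMeasure P N π) {f : E → ℝ}
    (hm : Measurable f) (hf : Integrable f π) {M : ℝ} (hM : ∀ x, |f x| ≤ M) :
    ∫⁻ ω, ENNReal.ofReal (Real.exp (∫ x, f x ∂(N ω))) ∂P ≤
      ENNReal.ofReal (Real.exp (∫ x, (Real.exp (f x) - 1) ∂π)) := by
  set s : ℕ → SimpleFunc E ℝ := fun n => SimpleFunc.approxOn f hm Set.univ 0 (Set.mem_univ _) n with hs
  have hlim (x) : Tendsto (fun n => s n x) atTop (𝓝 (f x)) :=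
    SimpleFunc.tendsto_approxOn hm (Set.mem_univ _) (by simp)
  have hle (n x) : |s n x| ≤ |f x| + |f x| :=
    SimpleFunc.norm_approxOn_zero_le hm (Set.mem_univ _) x n
  have hi (n) : Integrable (s n) π := by
    refine (hf.norm.add hf.norm).mono' (s n).aestronglyMeasurable (ae_of_all _ (hle n))
  have hN : ∀ᵐ ω ∂P, Tendsto (fun n => ENNReal.ofReal (Real.exp (∫ x, s n x ∂(N ω)))) atTop
      (𝓝 (ENNReal.ofReal (Real.exp (∫ x, f x ∂(N ω))))) := by
    filter_upwards [h.ae_integrable hf] with ω hω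
    refine ENNReal.tendsto_ofReal ((Real.continuous_exp.tendsto _).comp ?_)
    exact tendsto_integral_of_dominated_convergence _ (fun n => (s n).aestronglyMeasurable)
      (hω.norm.add hω.norm) (fun n => ae_of_all _ (hle n)) (ae_of_all _ hlim)
  have hπ : Tendsto (fun n => ENNReal.ofReal (Real.exp (∫ x, (Real.exp (s n x) - 1) ∂π))) atTop
      (𝓝 (ENNReal.ofReal (Real.exp (∫ x, (Real.exp (f x) - 1) ∂π)))) := by
    refine ENNReal.tendsto_ofReal ((Real.continuous_exp.tendsto _).comp ?_)
    refine tendsto_integral_of_dominated_convergence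
      (fun x => (|f x| + |f x|) * Real.exp (M + M))
      (fun n => by
        exact ((Real.measurable_exp.comp (s n).measurable).sub_const 1).aestronglyMeasurable)
      ((hf.norm.add hf.norm).mul_const _) (fun n => ae_of_all _ fun x => ?_)
      (ae_of_all _ fun x => ((Real.continuous_exp.tendsto _).comp (hlim x)).sub_const 1)
    refine (Real.abs_exp_sub_one_le_mul_exp_abs _).trans ?_
    gcongr
    · exact hle n x
    · exact (hle n x).trans (add_le_add (hM x) (hM x))
  calc ∫⁻ ω, ENNReal.ofReal (Real.exp (∫ x, f x ∂(N ω))) ∂P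
      = ∫⁻ ω, liminf (fun n => ENNReal.ofReal (Real.exp (∫ x, s n x ∂(N ω)))) atTop ∂P :=
        lintegral_congr_ae (hN.mono fun ω hω => hω.liminf_eq.symm)
    _ ≤ liminf (fun n => ∫⁻ ω, ENNReal.ofReal (Real.exp (∫ x, s n x ∂(N ω))) ∂P) atTop :=
        lintegral_liminf_le' fun n =>
          (Real.measurable_exp.comp_aemeasurable (h.aemeasurable_integral (hi n))).ennreal_ofReal
    _ = _ := by
        simp only [h.lintegral_exp_integral_simpleFunc _ (hi _)]
        exact hπ.liminf_eq

lemma lintegral_exp_compInt_le (h : IsPoissonRandomMeasure P N π) {f : E → ℝ}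
    (hm : Measurable f) (hf : Integrable f π) {M : ℝ} (hM : ∀ x, |f x| ≤ M) :
    ∫⁻ ω, ENNReal.ofReal (Real.exp (compInt N π f ω)) ∂P ≤
      ENNReal.ofReal (Real.exp (∫ x, (Real.exp (f x) - 1 - f x) ∂π)) := by
  have hi : Integrable (fun x => Real.exp (f x) - 1) π := by
    refine (hf.norm.mul_const (Real.exp M)).mono'
      (((Real.measurable_exp.comp hm).sub_const 1).aestronglyMeasurable)
      (ae_of_all _ fun x => (Real.abs_exp_sub_one_le_mul_exp_abs _).trans ?_)
    gcongr
    · exact le_rfl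
    · exact hM x
  rw [integral_sub hi hf, sub_eq_add_neg, Real.exp_add, ENNReal.ofReal_mul (Real.exp_pos _).le]
  simp only [compInt, sub_eq_add_neg _ (∫ x, f x ∂π), Real.exp_add,
    ENNReal.ofReal_mul (Real.exp_pos _).le]
  rw [lintegral_mul_const' _ _ ENNReal.ofReal_ne_top]
  gcongr
  exact h.lintegral_exp_integral_le hm hf hM

end IsPoissonRandomMeasure

/-! ### Convergence in `L²` -/

lemma tendsto_eLpNorm_two_of_dominated {α : Type*} [MeasurableSpace α] {μ : Measure α}
    {F : ℕ → α → ℝ} {f g : α → ℝ} (hF : ∀ n, AEStronglyMeasurable (F n) μ) (hg : MemLp g 2 μ)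
    (hle : ∀ n, ∀ᵐ x ∂μ, |F n x| ≤ g x)
    (hlim : ∀ᵐ x ∂μ, Tendsto (fun n => F n x) atTop (𝓝 (f x))) :
    MemLp f 2 μ ∧ Tendsto (fun n => eLpNorm (fun x => F n x - f x) 2 μ) atTop (𝓝 0) := by
  have hfm : AEStronglyMeasurable f μ := aestronglyMeasurable_of_tendsto_ae _ hF hlim
  have hfle : ∀ᵐ x ∂μ, |f x| ≤ g x := by
    filter_upwards [ae_all_iff.2 hle, hlim] with x h1 h2
    exact le_of_tendsto' h2.abs h1
  have hf : MemLp f 2 μ := hg.mono' hfm hfle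
  refine ⟨hf, ?_⟩
  have hgi : ∫⁻ x, ENNReal.ofReal ((2 * g x) ^ 2) ∂μ ≠ ∞ :=
    (hg.const_mul 2).integrable_sq.lintegral_lt_top.ne
  have key : Tendsto (fun n => ∫⁻ x, ENNReal.ofReal ((F n x - f x) ^ 2) ∂μ) atTop
      (𝓝 (∫⁻ _, 0 ∂μ)) := by
    refine tendsto_lintegral_of_dominated_convergence' _
      (fun n => (((hF n).sub hfm).aemeasurable.pow_const 2).ennreal_ofReal)
      (fun n => ?_) hgi ?_
    · filter_upwards [hle n, hfle] with x h1 h2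
      refine ENNReal.ofReal_le_ofReal (sq_le_sq' ?_ ?_) <;>
        linarith [abs_le.1 h1, abs_le.1 h2]
    · filter_upwards [hlim] with x hx
      have := ((hx.sub_const (f x)).pow 2)
      simpa using ENNReal.tendsto_ofReal this
  have e (n) : eLpNorm (fun x => F n x - f x) 2 μ =
      (∫⁻ x, ENNReal.ofReal ((F n x - f x) ^ 2) ∂μ) ^ (1 / 2 : ℝ) := by
    rw [eLpNorm_eq_lintegral_rpow_enorm_toReal (by simp) (by simp)]
    simp only [ENNReal.toReal_ofNat, ENNReal.rpow_ofNat]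
    congr 2 with x
    rw [← sq_abs, ENNReal.ofReal_pow (abs_nonneg _), ← Real.norm_eq_abs, ofReal_norm]
  simp only [e]
  have := (ENNReal.continuous_rpow_const (y := 1 / 2)).tendsto _ |>.comp key
  simpa [Function.comp_def] using this

lemma tendsto_eLpNorm_of_tendsto_sub {α : Type*} [MeasurableSpace α] {μ : Measure α}
    {F : ℕ → α → ℝ} {f : α → ℝ} (hF : ∀ n, MemLp (F n) 2 μ) (hf : MemLp f 2 μ)
    (hlim : Tendsto (fun n => eLpNorm (fun x => F n x - f x) 2 μ) atTop (𝓝 0)) :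
    Tendsto (fun n => eLpNorm (F n) 2 μ) atTop (𝓝 (eLpNorm f 2 μ)) := by
  have h1 := (Lp.tendsto_Lp_iff_tendsto_eLpNorm'' F hF f hf).2 hlim
  have h2 := h1.norm
  simp only [Lp.norm_toLp] at h2
  exact (ENNReal.tendsto_toReal_iff (fun n => (hF n).2.ne) hf.2.ne).1 h2

/-- An almost sure limit of almost surely `m`-measurable random variables is almost surely
`m`-measurable. -/
lemma aestronglyMeasurable_of_ae_tendsto {Ω : Type*} {m m0 : MeasurableSpace Ω}
    {P : Measure Ω} {F : ℕ → Ω → ℝ} {f : Ω → ℝ} (hF : ∀ n, AEStronglyMeasurable[m] (F n) P)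
    (hlim : ∀ᵐ ω ∂P, Tendsto (fun n => F n ω) atTop (𝓝 (f ω))) :
    AEStronglyMeasurable[m] f P := by
  let G : ℕ → Ω → ℝ := fun k => (hF k).mk
  have hG (k) : Measurable[m] (G k) := (hF k).stronglyMeasurable_mk.measurable
  refine ⟨fun ω => limsup (fun k => G k ω) atTop, (Measurable.limsup hG).stronglyMeasurable, ?_⟩
  filter_upwards [hlim, ae_all_iff.2 fun k => (hF k).ae_eq_mk] with ω h1 h2
  exact (h1.congr fun k => h2 k).limsup_eq.symm

/-- An `L^p`-limit of almost surely `m`-measurable random variables is almost surely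
`m`-measurable. -/
lemma aestronglyMeasurable_of_tendsto_eLpNorm {Ω : Type*} {m m0 : MeasurableSpace Ω}
    {P : Measure Ω} {p : ℝ≥0∞} (hp : p ≠ 0) (hm : m ≤ m0) {F : ℕ → Ω → ℝ} {f : Ω → ℝ}
    (hF : ∀ n, AEStronglyMeasurable[m] (F n) P) (hf : AEStronglyMeasurable f P)
    (hlim : Tendsto (fun n => eLpNorm (fun x => F n x - f x) p P) atTop (𝓝 0)) :
    AEStronglyMeasurable[m] f P := by
  obtain ⟨ns, -, hns⟩ := (tendstoInMeasure_of_tendsto_eLpNorm hp (fun n => (hF n).mono hm) hf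
    hlim).exists_seq_tendsto_ae
  exact aestronglyMeasurable_of_ae_tendsto (fun k => hF (ns k)) hns

/-! ### Compensated integrals -/

/-- The set of jumps of size larger than `1 / (n + 1)`. -/
def bigJumps (n : ℕ) : Set (ℝ × ℝ) := {p | 1 / ((n : ℝ) + 1) < |p.2|}

lemma measurableSet_bigJumps (n : ℕ) : MeasurableSet (bigJumps n) :=
  measurableSet_lt measurable_const (by fun_prop)

lemma truncatedIntegral_eq {Ω : Type*} (N : Ω → Measure (ℝ × ℝ)) (π : Measure (ℝ × ℝ))
    (f : ℝ × ℝ → ℝ) (n : ℕ) :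
    truncatedIntegral N π f n = compInt N π ((bigJumps n).indicator f) := by
  ext ω
  rw [truncatedIntegral, compInt, integral_indicator (measurableSet_bigJumps n),
    integral_indicator (measurableSet_bigJumps n)]
  rfl

variable {Ω : Type*} [MeasurableSpace Ω] {P : Measure Ω} {N : Ω → Measure (ℝ × ℝ)}
  {π : Measure (ℝ × ℝ)} {f g : ℝ × ℝ → ℝ} {I J : Ω → ℝ}

lemma memLp_indicator_bigJumps (hf : MemLp f 2 π) (n : ℕ) :
    MemLp ((bigJumps n).indicator f) 2 π := hf.indicator (measurableSet_bigJumps n)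

lemma integrable_indicator_bigJumps (hfin : ∀ n, π (bigJumps n) < ∞) (hf : MemLp f 2 π) (n : ℕ) :
    Integrable ((bigJumps n).indicator f) π := by
  rw [integrable_indicator_iff (measurableSet_bigJumps n)]
  have : IsFiniteMeasure (π.restrict (bigJumps n)) := isFiniteMeasure_restrict.2 (hfin n).ne
  exact (hf.restrict (bigJumps n)).integrable (by norm_num)

lemma tendsto_eLpNorm_indicator_bigJumps (h0 : ∀ᵐ p ∂π, p.2 ≠ 0) (hf : MemLp f 2 π) :
    Tendsto (fun n => eLpNorm (fun p => (bigJumps n).indicator f p - f p) 2 π) atTop (𝓝 0) := by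
  refine (tendsto_eLpNorm_two_of_dominated (fun n => (memLp_indicator_bigJumps hf n).1) hf.abs
    (fun n => ae_of_all _ fun p => ?_) ?_).2
  · by_cases hp : p ∈ bigJumps n <;> simp [hp]
  · filter_upwards [h0] with p hp
    refine tendsto_const_nhds.congr' ?_
    have := (tendsto_one_div_add_atTop_nhds_zero_nat (𝕜 := ℝ)).eventually_lt_const
      (abs_pos.2 hp)
    filter_upwards [this] with n hn
    rw [Set.indicator_of_mem]
    exact hn

variable [IsProbabilityMeasure P]

lemma memLp_truncatedIntegral (h : IsPoissonRandomMeasure P N π)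
    (hfin : ∀ n, π (bigJumps n) < ∞) (hf : MemLp f 2 π) (n : ℕ) :
    MemLp (truncatedIntegral N π f n) 2 P := by
  rw [truncatedIntegral_eq]
  exact h.memLp_compInt (integrable_indicator_bigJumps hfin hf n) (memLp_indicator_bigJumps hf n)

/-- By the isometry, two truncated integrals are as far apart in L²(P) as the truncated integrands
in L²(π). The latter converge to f because π does not charge z = 0, so the former are Cauchy. -/
lemma IsPoissonRandomMeasure.exists_isCompensatedIntegral (h : IsPoissonRandomMeasure P N π)
    (hfin : ∀ n, π (bigJumps n) < ∞) (h0 : ∀ᵐ p ∂π, p.2 ≠ 0) (hf : MemLp f 2 π) :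
    ∃ I, IsCompensatedIntegral P N π f I := by
  have hF (n) := memLp_truncatedIntegral h hfin hf n
  have hf2 (n) := memLp_indicator_bigJumps hf n
  have hf1 (n) := integrable_indicator_bigJumps hfin hf n
  have hc : CauchySeq fun n => (hf2 n).toLp _ :=
    ((Lp.tendsto_Lp_iff_tendsto_eLpNorm'' _ hf2 f hf).2
      (tendsto_eLpNorm_indicator_bigJumps h0 hf)).cauchySeq
  have hd (n k) : dist ((hF n).toLp _) ((hF k).toLp _) = dist ((hf2 n).toLp _) ((hf2 k).toLp _) := by
    rw [dist_eq_norm, dist_eq_norm, ← MemLp.toLp_sub, ← MemLp.toLp_sub, Lp.norm_toLp,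
      Lp.norm_toLp, truncatedIntegral_eq, truncatedIntegral_eq,
      show compInt N π ((bigJumps n).indicator f) - compInt N π ((bigJumps k).indicator f)
        = fun ω => compInt N π ((bigJumps n).indicator f) ω -
          compInt N π ((bigJumps k).indicator f) ω from rfl,
      ← eLpNorm_congr_ae (h.compInt_sub (hf1 n) (hf1 k)),
      h.eLpNorm_compInt (f := fun x => (bigJumps n).indicator f x - (bigJumps k).indicator f x)
        ((hf1 n).sub (hf1 k)) ((hf2 n).sub (hf2 k))]
    rfl
  have hc' : CauchySeq fun n => (hF n).toLp _ := by
    rw [Metric.cauchySeq_iff] at hc ⊢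
    simpa only [hd] using hc
  obtain ⟨U, hU⟩ := cauchySeq_tendsto_of_complete hc'
  refine ⟨U, Lp.memLp U, ?_⟩
  rw [← Lp.toLp_coeFn U (Lp.memLp U)] at hU
  exact (Lp.tendsto_Lp_iff_tendsto_eLpNorm'' _ hF _ (Lp.memLp U)).1 hU

namespace IsCompensatedIntegral

omit [IsProbabilityMeasure P] in
lemma congr_right (hI : IsCompensatedIntegral P N π f I) (hIJ : I =ᵐ[P] J) :
    IsCompensatedIntegral P N π f J := by
  refine ⟨(memLp_congr_ae hIJ).1 hI.memLp, hI.tendsto.congr fun n => eLpNorm_congr_ae ?_⟩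
  filter_upwards [hIJ] with ω hω
  rw [hω]

omit [IsProbabilityMeasure P] in
lemma congr_left (h : IsPoissonRandomMeasure P N π) (hI : IsCompensatedIntegral P N π f I)
    (hfg : f =ᵐ[π] g) : IsCompensatedIntegral P N π g I := by
  refine ⟨hI.memLp, hI.tendsto.congr fun n => eLpNorm_congr_ae ?_⟩
  have : (bigJumps n).indicator f =ᵐ[π] (bigJumps n).indicator g := by
    filter_upwards [hfg] with p hp
    by_cases hb : p ∈ bigJumps n <;> simp [hb, hp]
  rw [truncatedIntegral_eq, truncatedIntegral_eq]
  filter_upwards [h.compInt_congr this] with ω hω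
  rw [hω]

omit [IsProbabilityMeasure P] in
lemma const_mul (hI : IsCompensatedIntegral P N π f I) (c : ℝ) :
    IsCompensatedIntegral P N π (fun p => c * f p) (fun ω => c * I ω) := by
  refine ⟨hI.memLp.const_mul c, ?_⟩
  have := ENNReal.Tendsto.const_mul hI.tendsto (Or.inr (enorm_ne_top (x := c)))
  rw [mul_zero] at this
  refine this.congr fun n => ?_
  rw [← eLpNorm_const_smul]
  congr 1 with ω
  have e : (bigJumps n).indicator (fun p => c * f p) = fun p => c * (bigJumps n).indicator f p := by
    ext p
    by_cases hp : p ∈ bigJumps n <;> simp [hp]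
  rw [truncatedIntegral_eq, truncatedIntegral_eq, e,
    IsPoissonRandomMeasure.compInt_const_mul]
  simp only [Pi.smul_apply, smul_eq_mul]
  ring

lemma add (h : IsPoissonRandomMeasure P N π) (hfin : ∀ n, π (bigJumps n) < ∞)
    (hf : MemLp f 2 π) (hg : MemLp g 2 π)
    (hI : IsCompensatedIntegral P N π f I) (hJ : IsCompensatedIntegral P N π g J) :
    IsCompensatedIntegral P N π (fun p => f p + g p) (fun ω => I ω + J ω) := by
  refine ⟨hI.memLp.add hJ.memLp, ?_⟩
  have hs := hI.tendsto.add hJ.tendsto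
  rw [add_zero] at hs
  refine tendsto_of_tendsto_of_tendsto_of_le_of_le tendsto_const_nhds hs (fun _ => zero_le)
    fun n => ?_
  refine le_trans (le_of_eq ?_) (eLpNorm_add_le
    ((memLp_truncatedIntegral h hfin hf n).1.sub hI.memLp.1)
    ((memLp_truncatedIntegral h hfin hg n).1.sub hJ.memLp.1) (by norm_num))
  refine eLpNorm_congr_ae ?_
  rw [truncatedIntegral_eq, truncatedIntegral_eq, truncatedIntegral_eq,
    show (bigJumps n).indicator (fun p => f p + g p) =
      fun p => (bigJumps n).indicator f p + (bigJumps n).indicator g p from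
      Set.indicator_add _ _ _]
  filter_upwards [h.compInt_add (integrable_indicator_bigJumps hfin hf n)
    (integrable_indicator_bigJumps hfin hg n)] with ω hω
  simp only [hω, Pi.add_apply]
  ring

lemma sub (h : IsPoissonRandomMeasure P N π) (hfin : ∀ n, π (bigJumps n) < ∞)
    (hf : MemLp f 2 π) (hg : MemLp g 2 π)
    (hI : IsCompensatedIntegral P N π f I) (hJ : IsCompensatedIntegral P N π g J) :
    IsCompensatedIntegral P N π (fun p => f p - g p) (fun ω => I ω - J ω) := by
  have := add h hfin hf (hg.const_mul (-1)) hI (hJ.const_mul (-1))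
  simpa [sub_eq_add_neg] using this

omit [IsProbabilityMeasure P] in
lemma zero : IsCompensatedIntegral P N π (fun _ => 0) (fun _ => 0) := by
  refine ⟨MemLp.zero, ?_⟩
  simp [truncatedIntegral]

lemma finset_sum (h : IsPoissonRandomMeasure P N π) (hfin : ∀ n, π (bigJumps n) < ∞)
    {ι : Type*} (s : Finset ι) {F : ι → ℝ × ℝ → ℝ} {X : ι → Ω → ℝ}
    (hF : ∀ i ∈ s, MemLp (F i) 2 π) (hX : ∀ i ∈ s, IsCompensatedIntegral P N π (F i) (X i)) :
    IsCompensatedIntegral P N π (fun p => ∑ i ∈ s, F i p) (fun ω => ∑ i ∈ s, X i ω) := by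
  classical
  induction s using Finset.induction_on with
  | empty => simpa using zero
  | insert i s hi ih =>
    simp only [Finset.sum_insert hi]
    refine add h hfin (hF i (by simp)) (memLp_finsetSum s fun j hj => hF j (by simp [hj]))
      (hX i (by simp)) (ih (fun j hj => hF j (by simp [hj])) fun j hj => hX j (by simp [hj]))

/-- The isometry for compensated integrals. -/
lemma eLpNorm_eq (h : IsPoissonRandomMeasure P N π) (hfin : ∀ n, π (bigJumps n) < ∞)
    (h0 : ∀ᵐ p ∂π, p.2 ≠ 0) (hf : MemLp f 2 π) (hI : IsCompensatedIntegral P N π f I) :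
    eLpNorm I 2 P = eLpNorm f 2 π := by
  have h1 := tendsto_eLpNorm_of_tendsto_sub (memLp_truncatedIntegral h hfin hf) hI.memLp hI.tendsto
  have h2 := tendsto_eLpNorm_of_tendsto_sub (memLp_indicator_bigJumps hf) hf
    (tendsto_eLpNorm_indicator_bigJumps h0 hf)
  refine tendsto_nhds_unique h1 (h2.congr fun n => ?_)
  rw [truncatedIntegral_eq, h.eLpNorm_compInt (integrable_indicator_bigJumps hfin hf n)
    (memLp_indicator_bigJumps hf n)]

/-- The difference I - J is a compensated integral of f - f = 0, so the isometry gives it norm zero.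
-/
lemma ae_eq (h : IsPoissonRandomMeasure P N π) (hfin : ∀ n, π (bigJumps n) < ∞)
    (h0 : ∀ᵐ p ∂π, p.2 ≠ 0) (hf : MemLp f 2 π) (hI : IsCompensatedIntegral P N π f I)
    (hJ : IsCompensatedIntegral P N π f J) : I =ᵐ[P] J := by
  have h1 := eLpNorm_eq h hfin h0 (hf.sub hf) (sub h hfin hf hf hI hJ)
  simp only [sub_self, eLpNorm_zero] at h1
  have h2 := (eLpNorm_eq_zero_iff (hI.memLp.sub hJ.memLp).1 (by norm_num)).1
    (h1.trans (by simp))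
  filter_upwards [h2] with ω hω
  exact sub_eq_zero.1 hω

/-- The compensated integrals of a dominated convergent sequence of integrands converge. -/
lemma tendsto_of_dominated (h : IsPoissonRandomMeasure P N π) (hfin : ∀ n, π (bigJumps n) < ∞)
    (h0 : ∀ᵐ p ∂π, p.2 ≠ 0) {F : ℕ → ℝ × ℝ → ℝ} {X : ℕ → Ω → ℝ}
    (hF : ∀ n, AEStronglyMeasurable (F n) π) (hg : MemLp g 2 π)
    (hle : ∀ n, ∀ᵐ x ∂π, |F n x| ≤ g x)
    (hlim : ∀ᵐ x ∂π, Tendsto (fun n => F n x) atTop (𝓝 (f x)))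
    (hX : ∀ n, IsCompensatedIntegral P N π (F n) (X n)) (hI : IsCompensatedIntegral P N π f I) :
    Tendsto (fun n => eLpNorm (fun ω => X n ω - I ω) 2 P) atTop (𝓝 0) := by
  obtain ⟨hf, hlim⟩ := tendsto_eLpNorm_two_of_dominated hF hg hle hlim
  have hF2 (n) : MemLp (F n) 2 π := hg.mono' (hF n) (hle n)
  exact hlim.congr fun n => (eLpNorm_eq h hfin h0 ((hF2 n).sub hf)
    (sub h hfin (hF2 n) hf (hX n) hI)).symm

end IsCompensatedIntegral

/-! ### The compensator -/

section Compensator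

variable {T : ℝ} {υ : Measure ℝ}

lemma IsSqIntegrableLevyMeasure.measure_lt_top (hυ : IsSqIntegrableLevyMeasure υ) {c : ℝ}
    (hc : 0 < c) : υ {z | c < |z|} < ∞ := by
  have h := mul_meas_ge_le_lintegral₀ (μ := υ) (f := fun z : ℝ => ENNReal.ofReal (z ^ 2))
    (by fun_prop) (ENNReal.ofReal (c ^ 2))
  have h2 : {z | c < |z|} ⊆ {z : ℝ | ENNReal.ofReal (c ^ 2) ≤ ENNReal.ofReal (z ^ 2)} := by
    intro z (hz : c < |z|)
    refine ENNReal.ofReal_le_ofReal ?_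
    rw [← sq_abs z]
    gcongr
  refine lt_of_le_of_lt (measure_mono h2) ?_
  by_contra hcon
  rw [not_lt, top_le_iff] at hcon
  rw [hcon, ENNReal.mul_top (by simpa using hc.ne')] at h
  exact absurd hυ.sq (not_lt.2 h)

lemma IsSqIntegrableLevyMeasure.sigmaFinite (hυ : IsSqIntegrableLevyMeasure υ) :
    SigmaFinite υ := by
  refine ⟨⟨⟨fun n : ℕ => {0} ∪ {z | 1 / ((n : ℝ) + 1) < |z|}, fun _ => trivial, fun n => ?_, ?_⟩⟩⟩
  · refine (measure_union_le _ _).trans_lt ?_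
    rw [hυ.zero, zero_add]
    exact hυ.measure_lt_top (by positivity)
  · refine Set.eq_univ_of_forall fun z => ?_
    rcases eq_or_ne z 0 with rfl | hz
    · exact Set.mem_iUnion.2 ⟨0, Or.inl rfl⟩
    · obtain ⟨n, hn⟩ := exists_nat_one_div_lt (abs_pos.2 hz)
      exact Set.mem_iUnion.2 ⟨n, Or.inr hn⟩

lemma IsSqIntegrableLevyMeasure.ae_ne_zero (hυ : IsSqIntegrableLevyMeasure υ) :
    ∀ᵐ z ∂υ, z ≠ 0 := by
  rw [ae_iff]; simpa using hυ.zero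

lemma IsSqIntegrableLevyMeasure.memLp_id (hυ : IsSqIntegrableLevyMeasure υ) :
    MemLp (fun z : ℝ => z) 2 υ := by
  refine (memLp_two_iff_integrable_sq aestronglyMeasurable_id).2 ⟨by fun_prop, ?_⟩
  rw [hasFiniteIntegral_iff_ofReal (ae_of_all _ fun _ => sq_nonneg _)]
  exact hυ.sq

lemma IsSqIntegrableLevyMeasure.memLp_of_abs_le (hυ : IsSqIntegrableLevyMeasure υ) {w : ℝ → ℝ}
    (hw : Measurable w) (hle : ∀ z, |w z| ≤ |z|) : MemLp w 2 υ :=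
  hυ.memLp_id.mono hw.aestronglyMeasurable (ae_of_all _ hle)

lemma ae_compensator_snd_ne_zero (hυ : IsSqIntegrableLevyMeasure υ) :
    ∀ᵐ p ∂(compensator T υ), p.2 ≠ 0 := by
  have := hυ.sigmaFinite
  exact Measure.quasiMeasurePreserving_snd.ae hυ.ae_ne_zero

lemma ae_compensator_fst {q : ℝ → Prop} (hυ : IsSqIntegrableLevyMeasure υ)
    (hq : ∀ᵐ t ∂(volume.restrict (Set.Icc 0 T)), q t) :
    ∀ᵐ p ∂(compensator T υ), q p.1 := by
  have := hυ.sigmaFinite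
  exact Measure.quasiMeasurePreserving_fst.ae hq

lemma compensator_bigJumps_lt_top (hυ : IsSqIntegrableLevyMeasure υ) (n : ℕ) :
    compensator T υ (bigJumps n) < ∞ := by
  have := hυ.sigmaFinite
  have e : bigJumps n = Set.univ ×ˢ {z | 1 / ((n : ℝ) + 1) < |z|} := by
    ext p; simp [bigJumps]
  rw [e, compensator, Measure.prod_prod]
  exact ENNReal.mul_lt_top (measure_lt_top _ _) (hυ.measure_lt_top (by positivity))

lemma memLp_compensator_mul (hυ : IsSqIntegrableLevyMeasure υ) {F g : ℝ → ℝ} {C : ℝ}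
    (hF : Measurable F) (hC : ∀ t, |F t| ≤ C) (hg : MemLp g 2 υ) :
    MemLp (fun p : ℝ × ℝ => F p.1 * g p.2) 2 (compensator T υ) := by
  have := hυ.sigmaFinite
  have hF2 : MemLp F 2 (volume.restrict (Set.Icc 0 T)) :=
    MemLp.of_bound hF.aestronglyMeasurable C (ae_of_all _ hC)
  have hm : AEStronglyMeasurable (fun p : ℝ × ℝ => F p.1 * g p.2) (compensator T υ) :=
    (hF.comp measurable_fst).aestronglyMeasurable.mul
      (hg.1.comp_quasiMeasurePreserving Measure.quasiMeasurePreserving_snd)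
  rw [memLp_two_iff_integrable_sq hm]
  simp only [mul_pow]
  exact hF2.integrable_sq.mul_prod hg.integrable_sq

lemma integral_compensator_mul {F g : ℝ → ℝ} (hυ : IsSqIntegrableLevyMeasure υ) :
    ∫ p, F p.1 * g p.2 ∂(compensator T υ) = (∫ t in Set.Icc 0 T, F t) * ∫ z, g z ∂υ := by
  have := hυ.sigmaFinite
  exact integral_prod_mul F g

lemma integral_indicator_Ioc {a b : ℝ} (ha : 0 ≤ a) (hab : a ≤ b) (hb : b ≤ T) :
    ∫ t in Set.Icc 0 T, (Set.Ioc a b).indicator (fun _ => (1 : ℝ)) t = b - a := by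
  rw [integral_indicator measurableSet_Ioc, Measure.restrict_restrict measurableSet_Ioc,
    Set.inter_eq_left.2 (show Set.Ioc a b ⊆ Set.Icc 0 T from
      fun t ht => ⟨ha.trans ht.1.le, ht.2.trans hb⟩)]
  simp [Measure.real, hab]

end Compensator

/-! ### Second moments of compensated integrals -/

lemma integral_sq_eq_of_eLpNorm_eq {α β : Type*} [MeasurableSpace α] [MeasurableSpace β]
    {μ : Measure α} {ν : Measure β} {f : α → ℝ} {g : β → ℝ} (hf : MemLp f 2 μ) (hg : MemLp g 2 ν)
    (h : eLpNorm f 2 μ = eLpNorm g 2 ν) : ∫ x, f x ^ 2 ∂μ = ∫ x, g x ^ 2 ∂ν := by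
  rw [hf.eLpNorm_eq_integral_rpow_norm (by simp) (by simp),
    hg.eLpNorm_eq_integral_rpow_norm (by simp) (by simp)] at h
  simp only [ENNReal.toReal_ofNat, Real.norm_eq_abs, Real.rpow_ofNat, sq_abs] at h
  have hf0 : 0 ≤ ∫ x, f x ^ 2 ∂μ := integral_nonneg fun _ => sq_nonneg _
  have hg0 : 0 ≤ ∫ x, g x ^ 2 ∂ν := integral_nonneg fun _ => sq_nonneg _
  rw [ENNReal.ofReal_eq_ofReal_iff (by positivity) (by positivity)] at h
  exact (Real.rpow_left_inj hf0 hg0 (by norm_num)).1 h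

section

variable {Ω : Type*} [MeasurableSpace Ω] {P : Measure Ω} [IsProbabilityMeasure P]
  {N : Ω → Measure (ℝ × ℝ)} {π : Measure (ℝ × ℝ)} {f : ℝ × ℝ → ℝ} {I : Ω → ℝ}

lemma IsCompensatedIntegral.integral_sq (h : IsPoissonRandomMeasure P N π)
    (hfin : ∀ n, π (bigJumps n) < ∞) (h0 : ∀ᵐ p ∂π, p.2 ≠ 0) (hf : MemLp f 2 π)
    (hI : IsCompensatedIntegral P N π f I) : ∫ ω, I ω ^ 2 ∂P = ∫ p, f p ^ 2 ∂π :=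
  integral_sq_eq_of_eLpNorm_eq hI.memLp hf (hI.eLpNorm_eq h hfin h0 hf)

lemma bigJumps_mono {n k : ℕ} (hnk : n ≤ k) : bigJumps n ⊆ bigJumps k := fun p hp =>
  lt_of_le_of_lt (by gcongr) (show 1 / ((n : ℝ) + 1) < |p.2| from hp)

/-- Once the integrand is cut off at level n, the truncations at all levels k ≥ n coincide, so the
defining sequence is eventually constant. -/
lemma isCompensatedIntegral_compInt (h : IsPoissonRandomMeasure P N π)
    (hfin : ∀ n, π (bigJumps n) < ∞) (hf : MemLp f 2 π) (n : ℕ) :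
    IsCompensatedIntegral P N π ((bigJumps n).indicator f)
      (compInt N π ((bigJumps n).indicator f)) := by
  refine ⟨h.memLp_compInt (integrable_indicator_bigJumps hfin hf n)
    (memLp_indicator_bigJumps hf n), ?_⟩
  refine tendsto_const_nhds.congr' ?_
  filter_upwards [eventually_ge_atTop n] with k hk
  rw [truncatedIntegral_eq, Set.indicator_indicator, Set.inter_eq_right.2 (bigJumps_mono hk)]
  simp

end

/-! ### Integrals over at most one jump -/

/-- The measure is a sum of unit masses. -/
def IsSumDirac {E : Type*} [MeasurableSpace E] (M : Measure E) : Prop :=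
  ∃ (ι : Type) (x : ι → E), M = Measure.sum fun i => Measure.dirac (x i)

lemma IsSumDirac.restrict_eq_dirac {E : Type*} [MeasurableSpace E] {M : Measure E}
    (hM : IsSumDirac M) {A : Set E} (hA : MeasurableSet A) (h1 : M A = 1) :
    ∃ p, M.restrict A = Measure.dirac p := by
  classical
  obtain ⟨ι, x, rfl⟩ := hM
  rw [Measure.sum_apply _ hA] at h1
  simp only [Measure.dirac_apply' _ hA] at h1
  obtain ⟨i, hi⟩ : ∃ i, x i ∈ A := by
    by_contra! hcon
    simp [hcon] at h1
  have huniq (j) (hj : j ≠ i) : x j ∉ A := by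
    intro hjA
    have := ENNReal.sum_le_tsum (f := fun i => A.indicator (1 : E → ℝ≥0∞) (x i)) {j, i}
    rw [h1, Finset.sum_pair hj] at this
    simp only [Set.indicator_of_mem hi, Set.indicator_of_mem hjA, Pi.one_apply] at this
    norm_num at this
  refine ⟨x i, Measure.ext fun s hs => ?_⟩
  rw [Measure.restrict_apply hs, Measure.sum_apply _ (hs.inter hA), tsum_eq_single i]
  · rw [Measure.dirac_apply' _ (hs.inter hA), Measure.dirac_apply' _ hs]
    by_cases hxs : x i ∈ s <;> simp [hxs, hi]
  · intro j hj
    simp [Measure.dirac_apply' _ (hs.inter hA), huniq j hj]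

/-- With at most one point in A the two terms coincide, because Φ(0) = 0. With k ≥ 2 points the
crude bound B + kB is at most 2B(k² - k). The factor k² - k is used because its Poisson mean is
quadratic in the mass of A. -/
lemma IsSumDirac.abs_comp_integral_sub_le {E : Type*} [MeasurableSpace E]
    [MeasurableSingletonClass E] {M : Measure E}
    (hM : IsSumDirac M) {A : Set E} (hA : MeasurableSet A) {k : ℕ} (hk : M A = k) {Φ : ℝ → ℝ}
    {B : ℝ} (hΦ0 : Φ 0 = 0) (hB : ∀ x, |Φ x| ≤ B) (w : E → ℝ) :
    |Φ (∫ x in A, w x ∂M) - ∫ x in A, Φ (w x) ∂M| ≤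
      2 * B * ((M A).toReal * (M A).toReal - (M A).toReal) := by
  rcases k with _ | _ | k
  · have : M.restrict A = 0 := Measure.restrict_eq_zero.2 (by simpa using hk)
    simp [this, hΦ0, hk]
  · obtain ⟨p, hp⟩ := hM.restrict_eq_dirac hA (by simpa using hk)
    rw [hp, integral_dirac, integral_dirac]
    simp [hk]
  · have hB0 : 0 ≤ B := (abs_nonneg _).trans (hB 0)
    have h1 : |∫ x in A, Φ (w x) ∂M| ≤ B * (M A).toReal :=
      norm_setIntegral_le_of_norm_le_const (f := fun x => Φ (w x))
        (hk ▸ ENNReal.natCast_lt_top _) fun x _ => hB _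
    have h2 := (abs_sub _ _).trans (add_le_add (hB (∫ x in A, w x ∂M)) h1)
    refine h2.trans ?_
    rw [hk, ENNReal.toReal_natCast]
    push_cast
    nlinarith [mul_nonneg hB0 (Nat.cast_nonneg (α := ℝ) k), mul_nonneg hB0 (sq_nonneg (k : ℝ))]

/-! ### Recovering jumps from increments -/

/-- A modulus of continuity in quadratic form, so that expectations can be taken by the isometry.
For close x and y, either both lie where Φ vanishes, or x² + y² ≥ η² and the first term absorbs the
difference. For distant points the second term exceeds 2B. -/
lemma exists_modulus_of_uniformContinuous {Φ : ℝ → ℝ} (hΦ : UniformContinuous Φ) {B η : ℝ}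
    (hB : ∀ x, |Φ x| ≤ B) (hη : 0 < η) (h0 : ∀ x, |x| ≤ η → Φ x = 0) {ε : ℝ} (hε : 0 < ε) :
    ∃ C, 0 ≤ C ∧ ∀ x y, |Φ x - Φ y| ≤ ε * (x ^ 2 + y ^ 2) + C * (x - y) ^ 2 := by
  obtain ⟨κ, hκ, h⟩ := Metric.uniformContinuous_iff.1 hΦ (ε * η ^ 2) (by positivity)
  have hB0 : 0 ≤ B := (abs_nonneg _).trans (hB 0)
  refine ⟨2 * B / κ ^ 2, by positivity, fun x y => ?_⟩
  by_cases hxy : |x - y| < κ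
  · have hC : 0 ≤ 2 * B / κ ^ 2 * (x - y) ^ 2 := by positivity
    by_cases hx : |x| ≤ η ∧ |y| ≤ η
    · rw [h0 x hx.1, h0 y hx.2]
      simp only [sub_self, abs_zero]
      positivity
    · have : η ^ 2 ≤ x ^ 2 + y ^ 2 := by
        rw [not_and_or, not_le, not_le] at hx
        rcases hx with hx | hx
        · nlinarith [sq_abs x, sq_nonneg y, abs_nonneg x]
        · nlinarith [sq_abs y, sq_nonneg x, abs_nonneg y]
      have h1 : |Φ x - Φ y| < ε * η ^ 2 := h hxy
      nlinarith
  · have h1 : |Φ x - Φ y| ≤ 2 * B :=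
      (abs_sub _ _).trans (by linarith [hB x, hB y])
    have h2 : 2 * B ≤ 2 * B / κ ^ 2 * (x - y) ^ 2 := by
      rw [div_mul_eq_mul_div, le_div_iff₀ (by positivity)]
      have : κ ^ 2 ≤ (x - y) ^ 2 := by
        rw [← sq_abs (x - y)]
        gcongr
        exact not_lt.1 hxy
      gcongr
    have : 0 ≤ ε * (x ^ 2 + y ^ 2) := by positivity
    linarith

/-- The integrand `1_{(a, b]}(t) w(z)`. -/
noncomputable def slab (a b : ℝ) (w : ℝ → ℝ) (p : ℝ × ℝ) : ℝ :=
  (Set.Ioc a b).indicator (fun _ => (1 : ℝ)) p.1 * w p.2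

/-- The set of sizes larger than `1 / (n + 1)`. -/
def bigSizes (n : ℕ) : Set ℝ := {z | 1 / ((n : ℝ) + 1) < |z|}

lemma measurableSet_bigSizes (n : ℕ) : MeasurableSet (bigSizes n) :=
  measurableSet_lt measurable_const (by fun_prop)

lemma eventually_mem_bigSizes {z : ℝ} (hz : z ≠ 0) : ∀ᶠ n in atTop, z ∈ bigSizes n :=
  (tendsto_one_div_add_atTop_nhds_zero_nat (𝕜 := ℝ)).eventually_lt_const (abs_pos.2 hz)

lemma abs_le_of_notMem_bigSizes {n₀ n : ℕ} (hn : n₀ ≤ n) {z : ℝ} (hz : z ∉ bigSizes n) :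
    |z| ≤ 1 / ((n₀ : ℝ) + 1) :=
  (not_lt.1 hz).trans (by gcongr)

section Slab

variable {T : ℝ} {υ : Measure ℝ} {a b : ℝ} {w : ℝ → ℝ}

lemma abs_indicator_one_le (s : Set ℝ) (t : ℝ) : |s.indicator (fun _ => (1 : ℝ)) t| ≤ 1 := by
  by_cases h : t ∈ s <;> simp [h]

lemma memLp_slab (hυ : IsSqIntegrableLevyMeasure υ) (a b : ℝ) (hw : MemLp w 2 υ) :
    MemLp (slab a b w) 2 (compensator T υ) :=
  memLp_compensator_mul hυ (measurable_const.indicator measurableSet_Ioc)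
    (abs_indicator_one_le _) hw

lemma integral_slab (hυ : IsSqIntegrableLevyMeasure υ) (ha : 0 ≤ a) (hab : a ≤ b) (hb : b ≤ T)
    (w : ℝ → ℝ) : ∫ p, slab a b w p ∂(compensator T υ) = (b - a) * ∫ z, w z ∂υ := by
  rw [← integral_indicator_Ioc ha hab hb]
  exact integral_compensator_mul hυ

lemma slab_sq (a b : ℝ) (w : ℝ → ℝ) (p : ℝ × ℝ) :
    slab a b w p ^ 2 = slab a b (fun z => w z ^ 2) p := by
  by_cases h : p.1 ∈ Set.Ioc a b <;> simp [slab, h]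

lemma integral_slab_sq (hυ : IsSqIntegrableLevyMeasure υ) (ha : 0 ≤ a) (hab : a ≤ b) (hb : b ≤ T)
    (w : ℝ → ℝ) : ∫ p, slab a b w p ^ 2 ∂(compensator T υ) = (b - a) * ∫ z, w z ^ 2 ∂υ := by
  simp only [slab_sq]
  exact integral_slab hυ ha hab hb _

lemma indicator_bigJumps_slab (n : ℕ) (a b : ℝ) (w : ℝ → ℝ) :
    (bigJumps n).indicator (slab a b w) = slab a b ((bigSizes n).indicator w) := by
  ext p
  by_cases h : p.2 ∈ bigSizes n
  · rw [Set.indicator_of_mem (show p ∈ bigJumps n from h), slab, slab, Set.indicator_of_mem h]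
  · rw [Set.indicator_of_notMem (show p ∉ bigJumps n from h), slab, Set.indicator_of_notMem h,
      mul_zero]

lemma tendsto_integral_sq_sub_indicator_bigSizes (hυ : IsSqIntegrableLevyMeasure υ)
    (hw : Measurable w) (hw2 : MemLp w 2 υ) :
    Tendsto (fun n => ∫ z, (w z - (bigSizes n).indicator w z) ^ 2 ∂υ) atTop (𝓝 0) := by
  have := tendsto_integral_of_dominated_convergence (μ := υ)
    (F := fun n z => (w z - (bigSizes n).indicator w z) ^ 2) (f := fun _ => 0) (fun z => w z ^ 2)
    (fun n => ((hw.sub (hw.indicator (measurableSet_bigSizes n))).pow_const 2).aestronglyMeasurable)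
    hw2.integrable_sq
    (fun n => ae_of_all _ fun z => by
      by_cases hz : z ∈ bigSizes n <;> simp [hz, sq_nonneg])
    (by
      filter_upwards [hυ.ae_ne_zero] with z hz
      refine tendsto_const_nhds.congr' ?_
      filter_upwards [eventually_mem_bigSizes hz] with n hn
      simp [hn])
  simpa using this

lemma sum_slab {u : ℕ → ℝ} (hu : Monotone u) (k : ℕ) (w : ℝ → ℝ) (p : ℝ × ℝ) :
    ∑ i ∈ Finset.range k, slab (u i) (u (i + 1)) w p = slab (u 0) (u k) w p := by
  have e {a b : ℝ} (hab : a ≤ b) : slab a b w p =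
      (Set.Iic b).indicator (fun _ => (1 : ℝ)) p.1 * w p.2 -
        (Set.Iic a).indicator (fun _ => (1 : ℝ)) p.1 * w p.2 := by
    rw [slab, ← sub_mul]
    congr 1
    by_cases h1 : p.1 ≤ a
    · simp [h1, h1.trans hab, not_lt.2 h1]
    · by_cases h2 : p.1 ≤ b <;> simp [h1, h2, not_le.1 h1]
  rw [e (hu (Nat.zero_le k)), ← Finset.sum_range_sub
    (fun i => (Set.Iic (u i)).indicator (fun _ => (1 : ℝ)) p.1 * w p.2)]
  exact Finset.sum_congr rfl fun i _ => e (hu (Nat.le_succ i))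

end Slab

/-! ### Increments over one short interval -/

section Increment

variable {Ω : Type*} [MeasurableSpace Ω] {P : Measure Ω} [IsProbabilityMeasure P]
  {N : Ω → Measure (ℝ × ℝ)} {T : ℝ} {υ : Measure ℝ}

/-- The region `(a, b] × {|z| > 1 / (n + 1)}`. -/
def slabSet (a b : ℝ) (n : ℕ) : Set (ℝ × ℝ) := Set.Ioc a b ×ˢ bigSizes n

lemma measurableSet_slabSet (a b : ℝ) (n : ℕ) : MeasurableSet (slabSet a b n) :=
  measurableSet_Ioc.prod (measurableSet_bigSizes n)

lemma indicator_slabSet (a b : ℝ) (n : ℕ) (w : ℝ → ℝ) :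
    (slabSet a b n).indicator (fun p => w p.2) = slab a b ((bigSizes n).indicator w) := by
  ext p
  by_cases h1 : p.1 ∈ Set.Ioc a b
  · by_cases h2 : p.2 ∈ bigSizes n
    · rw [Set.indicator_of_mem (show p ∈ slabSet a b n from ⟨h1, h2⟩), slab,
        Set.indicator_of_mem h1, Set.indicator_of_mem h2, one_mul]
    · rw [Set.indicator_of_notMem (show p ∉ slabSet a b n from fun h => h2 h.2), slab,
        Set.indicator_of_notMem h2, mul_zero]
  · rw [Set.indicator_of_notMem (show p ∉ slabSet a b n from fun h => h1 h.1), slab,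
      Set.indicator_of_notMem h1, zero_mul]

lemma slab_eq_indicator_slabSet (a b : ℝ) {n₀ n : ℕ} (hn : n₀ ≤ n) {w : ℝ → ℝ}
    (h0 : ∀ z, |z| ≤ 1 / ((n₀ : ℝ) + 1) → w z = 0) :
    slab a b w = (slabSet a b n).indicator (fun p => w p.2) := by
  rw [indicator_slabSet]
  congr 1
  ext z
  by_cases hz : z ∈ bigSizes n
  · rw [Set.indicator_of_mem hz]
  · rw [Set.indicator_of_notMem hz, h0 z (abs_le_of_notMem_bigSizes hn hz)]

lemma integrable_slab_of_bounded {π : Measure (ℝ × ℝ)} {a b : ℝ} {n₀ : ℕ}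
    (hfin : π (slabSet a b n₀) ≠ ∞) {w : ℝ → ℝ} (hw : Measurable w) {B : ℝ} (hB : ∀ z, |w z| ≤ B)
    (h0 : ∀ z, |z| ≤ 1 / ((n₀ : ℝ) + 1) → w z = 0) : Integrable (slab a b w) π := by
  have mA := measurableSet_slabSet a b n₀
  rw [slab_eq_indicator_slabSet a b le_rfl h0, integrable_indicator_iff mA]
  have : IsFiniteMeasure (π.restrict (slabSet a b n₀)) := isFiniteMeasure_restrict.2 hfin
  exact Integrable.of_bound (hw.comp measurable_snd).aestronglyMeasurable B
    (ae_of_all _ fun p => hB p.2)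

lemma compensator_slabSet (hυ : IsSqIntegrableLevyMeasure υ) {a b : ℝ} (ha : 0 ≤ a) (hb : b ≤ T)
    (n : ℕ) : compensator T υ (slabSet a b n) =
      ENNReal.ofReal (b - a) * υ (bigSizes n) := by
  have := hυ.sigmaFinite
  rw [compensator, slabSet, Measure.prod_prod, Measure.restrict_apply measurableSet_Ioc,
    Set.inter_eq_left.2 (show Set.Ioc a b ⊆ Set.Icc 0 T from
      fun t ht => ⟨ha.trans ht.1.le, ht.2.trans hb⟩), Real.volume_Ioc]

-- The second factorial moment of a Poisson variable is the square of its mean. On a slab it is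
-- therefore quadratic in the length of the interval, which makes multiple jumps negligible.
omit [IsProbabilityMeasure P] in
lemma IsPoissonRandomMeasure.integral_sq_sub_self {E : Type*} [MeasurableSpace E]
    {N : Ω → Measure E} {π : Measure E} (h : IsPoissonRandomMeasure P N π) {A : Set E}
    (hA : MeasurableSet A) (hfin : π A ≠ ∞) :
    Integrable (fun ω => (N ω A).toReal * (N ω A).toReal - (N ω A).toReal) P ∧
    ∫ ω, ((N ω A).toReal * (N ω A).toReal - (N ω A).toReal) ∂P = (π A).toReal ^ 2 := by
  have m1 := h.aemeasurable_apply hA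
  have m2 : AEMeasurable (fun ω => N ω A * N ω A) P := m1.mul m1
  have e1 := h.lintegral_apply hA
  have e2 := h.lintegral_apply_sq hA
  have f2 : π A * π A + π A ≠ ∞ := by finiteness
  have i1 := integrable_toReal_of_lintegral_ne_top m1 (e1 ▸ hfin)
  have i2 := integrable_toReal_of_lintegral_ne_top m2 (e2 ▸ f2)
  have r1 := integral_toReal m1 (ae_lt_top' m1 (e1 ▸ hfin))
  have r2 := integral_toReal m2 (ae_lt_top' m2 (e2 ▸ f2))
  rw [e1] at r1
  rw [e2, ENNReal.toReal_add (by finiteness) hfin] at r2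
  simp only [ENNReal.toReal_mul] at i2 r2
  refine ⟨i2.sub i1, ?_⟩
  rw [integral_sub i2 i1, r1, r2]
  ring

omit [IsProbabilityMeasure P] in
lemma IsPoissonRandomMeasure.ae_exists_natCast {E : Type*} [MeasurableSpace E]
    {N : Ω → Measure E} {π : Measure E} (h : IsPoissonRandomMeasure P N π) {A : Set E}
    (hA : MeasurableSet A) (hfin : π A ≠ ∞) : ∀ᵐ ω ∂P, ∃ k : ℕ, N ω A = (k : ℝ≥0∞) := by
  have := ae_exists_natCast_poissonLaw hfin
  rw [← (h.hasLaw A hA).map_eq] at this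
  exact ae_of_ae_map (h.aemeasurable_apply hA) this

/-- Applied with x the increment, y its sum over large jumps, e the compensated small jumps and d
the compensating drift. Eliminating y leaves only squares whose expectations are known. -/
lemma modulus_aux {ε C x y e d : ℝ} (hε : 0 ≤ ε) (hC : 0 ≤ C) (h : x - y = e - d) :
    ε * (x ^ 2 + y ^ 2) + C * (x - y) ^ 2 ≤
      3 * ε * x ^ 2 + ((2 * ε + C) * 2 * e ^ 2 + (2 * ε + C) * (2 * d ^ 2)) := by
  have h4 : (x - y) ^ 2 ≤ 2 * e ^ 2 + 2 * d ^ 2 := by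
    rw [h]; nlinarith [sq_nonneg (e + d)]
  have h5 : y ^ 2 ≤ 2 * x ^ 2 + 2 * (x - y) ^ 2 := by nlinarith [sq_nonneg (2 * x - y)]
  have h6 := mul_le_mul_of_nonneg_left h5 hε
  have h7 := mul_le_mul_of_nonneg_left h4 (show 0 ≤ 2 * ε + C by positivity)
  linarith

/-- For a short interval `(a, b]`, a functional of the increment of the compensated integral of `w`
is close to the corresponding sum over the jumps. -/
lemma exists_integral_abs_sub_le (h : IsPoissonRandomMeasure P N (compensator T υ))
    (hυ : IsSqIntegrableLevyMeasure υ) (hN : ∀ ω, IsSumDirac (N ω)) {w : ℝ → ℝ}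
    (hw : Measurable w) (hwle : ∀ z, |w z| ≤ |z|) {Φ : ℝ → ℝ} (hΦ : UniformContinuous Φ) {B : ℝ}
    (hB : ∀ x, |Φ x| ≤ B) {n₀ : ℕ} (h0 : ∀ x, |x| ≤ 1 / ((n₀ : ℝ) + 1) → Φ x = 0) {ε : ℝ}
    (hε : 0 < ε) :
    ∃ δ > 0, ∀ a b, 0 ≤ a → a ≤ b → b ≤ T → b - a ≤ δ → ∀ W : Ω → ℝ,
      IsCompensatedIntegral P N (compensator T υ) (slab a b w) W →
      Integrable (fun ω => Φ (W ω) - ∫ p, slab a b (fun z => Φ (w z)) p ∂(N ω)) P ∧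
      ∫ ω, |Φ (W ω) - ∫ p, slab a b (fun z => Φ (w z)) p ∂(N ω)| ∂P ≤ ε * (b - a) := by
  have hw2 := hυ.memLp_of_abs_le hw hwle
  have hfin := fun n => compensator_bigJumps_lt_top (T := T) hυ n
  have hne := ae_compensator_snd_ne_zero (T := T) hυ
  have hB0 : 0 ≤ B := (abs_nonneg _).trans (hB 0)
  set q := ∫ z, w z ^ 2 ∂υ with hq
  have hq0 : 0 ≤ q := integral_nonneg fun _ => sq_nonneg _
  -- The error is split into three parts of size at most (ε / 4)(b - a). This choice handles the
  -- term 3 ε₁ W², and q + 1 avoids dividing by zero.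
  set ε₁ := ε / (12 * (q + 1)) with hε₁
  have hε₁0 : 0 < ε₁ := by positivity
  have hε₁q : 3 * ε₁ * q ≤ ε / 4 := by
    rw [hε₁, mul_div_assoc', div_mul_eq_mul_div, div_le_iff₀ (by positivity)]
    nlinarith
  obtain ⟨C, hC0, hC⟩ := exists_modulus_of_uniformContinuous hΦ hB
    (η := 1 / ((n₀ : ℝ) + 1)) (by positivity) h0 hε₁0
  set D := 2 * ε₁ + C with hD
  have hD0 : 0 < D := by positivity
  have hwn2 (n) : MemLp ((bigSizes n).indicator w) 2 υ := hw2.indicator (measurableSet_bigSizes n)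
  -- `D` is already fixed, so the cutoff can make the small jumps cheap. Taking n ≥ n₀ ensures that
  -- Φ ∘ w vanishes on the sizes discarded.
  obtain ⟨n, hnr, hn0⟩ : ∃ n, D * (2 * ∫ z, (w z - (bigSizes n).indicator w z) ^ 2 ∂υ) < ε / 4 ∧
      n₀ ≤ n := by
    have h1 := ((tendsto_integral_sq_sub_indicator_bigSizes hυ hw hw2).const_mul 2).const_mul D
    simp only [mul_zero] at h1
    exact ((h1.eventually_lt_const (by positivity)).and (eventually_ge_atTop n₀)).exists
  set wn := (bigSizes n).indicator w with hwn
  set r := ∫ z, (w z - wn z) ^ 2 ∂υ with hrdef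
  set c := ∫ z, wn z ∂υ with hc
  set m := (υ (bigSizes n)).toReal with hm
  -- The squared drift and the double jumps contribute terms quadratic in b - a. This length makes
  -- them at most (ε / 4)(b - a).
  refine ⟨ε / (4 * (D * (2 * c ^ 2) + 2 * B * m ^ 2 + 1)), by positivity,
    fun a b ha hab hb hδ W hW => ?_⟩
  rw [le_div_iff₀ (by positivity)] at hδ
  set δ := b - a with hδdef
  have hδ0 : 0 ≤ δ := by linarith
  set A := slabSet a b n with hA
  have mA : MeasurableSet A := measurableSet_slabSet a b n
  have hπA (k) : compensator T υ (slabSet a b k) = ENNReal.ofReal δ * υ (bigSizes k) :=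
    compensator_slabSet hυ ha hb k
  have hυn (k) : υ (bigSizes k) ≠ ∞ := (hυ.measure_lt_top (by positivity)).ne
  have hAfin (k) : compensator T υ (slabSet a b k) ≠ ∞ := by
    rw [hπA]; exact ENNReal.mul_ne_top ENNReal.ofReal_ne_top (hυn k)
  have hπA' : (compensator T υ A).toReal = δ * m := by
    rw [hA, hπA, ENNReal.toReal_mul, ENNReal.toReal_ofReal hδ0]
  set S : Ω → ℝ := fun ω => ∫ p in A, w p.2 ∂(N ω) with hS
  set K : Ω → ℝ := fun ω => ∫ p, slab a b (fun z => Φ (w z)) p ∂(N ω) with hK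
  set ν : Ω → ℝ := fun ω => (N ω A).toReal with hν
  have hw0 (z : ℝ) (hz : |z| ≤ 1 / ((n₀ : ℝ) + 1)) : Φ (w z) = 0 := h0 _ ((hwle z).trans hz)
  have hKA (ω) : K ω = ∫ p in A, Φ (w p.2) ∂(N ω) := by
    simp only [hK]
    rw [slab_eq_indicator_slabSet a b hn0 hw0, integral_indicator mA]
  have hSA (ω) : S ω = ∫ p, slab a b wn p ∂(N ω) := by
    rw [hwn, ← indicator_slabSet, integral_indicator mA]
  have hslab := memLp_slab (T := T) hυ a b hw2
  have hslabn := memLp_slab (T := T) hυ a b (hwn2 n)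
  have hX := isCompensatedIntegral_compInt h hfin hslab n
  rw [indicator_bigJumps_slab, ← hwn] at hX
  set X := compInt N (compensator T υ) (slab a b wn) with hXdef
  have hXS (ω) : X ω = S ω - δ * c := by
    rw [hXdef, compInt, hSA, integral_slab hυ ha hab hb]
  have hWX := hW.sub h hfin hslab hslabn hX
  have hW2 : ∫ ω, W ω ^ 2 ∂P = δ * q := by
    rw [hW.integral_sq h hfin hne hslab, integral_slab_sq hυ ha hab hb]
  have hWX2 : ∫ ω, (W ω - X ω) ^ 2 ∂P = δ * r := by
    rw [hWX.integral_sq h hfin hne (hslab.sub hslabn), hrdef, ← integral_slab_sq hυ ha hab hb]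
    congr 1 with p
    simp only [slab, Pi.sub_apply]
    ring
  have iW := hW.memLp.integrable_sq
  have iWX := hWX.memLp.integrable_sq
  obtain ⟨iν, eν⟩ := h.integral_sq_sub_self mA (hAfin n)
  have eν' : ∫ ω, (ν ω * ν ω - ν ω) ∂P = (δ * m) ^ 2 := by rw [← hπA']; exact eν
  have hΦ0 : Φ 0 = 0 := h0 0 (by simp; positivity)
  -- Compare through Φ(S): passing from W to S uses the modulus, and passing from S to K costs only
  -- when there are two or more large jumps.
  have hbound : ∀ᵐ ω ∂P, |Φ (W ω) - K ω| ≤ (3 * ε₁ * W ω ^ 2 +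
      (D * 2 * (W ω - X ω) ^ 2 + D * (2 * (δ * c) ^ 2))) + 2 * B * (ν ω * ν ω - ν ω) := by
    filter_upwards [h.ae_exists_natCast mA (hAfin n)] with ω ⟨k, hk⟩
    have h1 := (hN ω).abs_comp_integral_sub_le mA hk hΦ0 hB (fun p : ℝ × ℝ => w p.2)
    rw [← hKA ω] at h1
    have h3 : W ω - S ω = (W ω - X ω) - δ * c := by rw [hXS]; ring
    exact (abs_sub_le _ (Φ (S ω)) _).trans
      (add_le_add ((hC (W ω) (S ω)).trans (modulus_aux hε₁0.le hC0 h3)) h1)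
  have ib : Integrable (fun ω => (3 * ε₁ * W ω ^ 2 +
      (D * 2 * (W ω - X ω) ^ 2 + D * (2 * (δ * c) ^ 2))) + 2 * B * (ν ω * ν ω - ν ω)) P :=
    ((iW.const_mul _).add ((iWX.const_mul _).add (integrable_const _))).add (iν.const_mul _)
  have hΦw : Integrable (slab a b fun z => Φ (w z)) (compensator T υ) :=
    integrable_slab_of_bounded (hAfin n₀) (hΦ.continuous.measurable.comp hw) (fun z => hB _) hw0
  have hmeasK : AEStronglyMeasurable (fun ω => Φ (W ω) - K ω) P :=
    (hΦ.continuous.comp_aestronglyMeasurable hW.memLp.1).sub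
      (h.aemeasurable_integral hΦw).aestronglyMeasurable
  have hint : Integrable (fun ω => Φ (W ω) - K ω) P := ib.mono' hmeasK hbound
  refine ⟨hint, (integral_mono_ae hint.abs ib hbound).trans ?_⟩
  rw [integral_add (by exact (iW.const_mul _).add ((iWX.const_mul _).add (integrable_const _)))
      (by exact iν.const_mul _),
    integral_add (by exact iW.const_mul _) (by exact (iWX.const_mul _).add (integrable_const _)),
    integral_add (by exact iWX.const_mul _) (integrable_const _), integral_const_mul,
    integral_const_mul, integral_const_mul, integral_const_mul, integral_const_mul, hW2, hWX2, eν']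
  simp only [integral_const, probReal_univ, one_smul]
  have key : (D * (2 * c ^ 2) + 2 * B * m ^ 2) * δ ≤ ε / 4 := by linarith
  calc _ = δ * (3 * ε₁ * q + D * (2 * r) + (D * (2 * c ^ 2) + 2 * B * m ^ 2) * δ) := by ring
    _ ≤ δ * (ε / 4 + ε / 4 + ε / 4) := by gcongr
    _ ≤ ε * δ := by linarith [mul_nonneg hδ0 hε.le]

end Increment

/-! ### Summation over a partition -/

section Recover

variable {Ω : Type*} {m : MeasurableSpace Ω} [m0 : MeasurableSpace Ω] {P : Measure Ω}
  [IsProbabilityMeasure P] {N : Ω → Measure (ℝ × ℝ)} {T : ℝ} {υ : Measure ℝ}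

omit [IsProbabilityMeasure P] in
lemma aestronglyMeasurable_finset_sum {ι : Type*} {s : Finset ι} {F : ι → Ω → ℝ}
    (hF : ∀ i ∈ s, AEStronglyMeasurable[m] (F i) P) :
    AEStronglyMeasurable[m] (fun ω => ∑ i ∈ s, F i ω) P := by
  classical
  induction s using Finset.induction_on with
  | empty => simpa using aestronglyMeasurable_const
  | insert i s hi ih =>
    simp only [Finset.sum_insert hi]
    exact (hF i (by simp)).add (ih fun j hj => hF j (by simp [hj]))

/-- If the compensated integrals of `1_{(a, b]}(t) w(z)` are almost surely `m`-measurable, so are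
those of `1_{(s, t]}(t) Φ(w(z))`, for uniformly continuous bounded `Φ` vanishing near `0`. -/
lemma aestronglyMeasurable_slab_comp (hm : m ≤ m0)
    (h : IsPoissonRandomMeasure P N (compensator T υ))
    (hυ : IsSqIntegrableLevyMeasure υ) (hN : ∀ ω, IsSumDirac (N ω)) {w : ℝ → ℝ}
    (hw : Measurable w) (hwle : ∀ z, |w z| ≤ |z|) {Φ : ℝ → ℝ} (hΦ : UniformContinuous Φ) {B : ℝ}
    (hB : ∀ x, |Φ x| ≤ B) {η : ℝ} (hη : 0 < η) (h0 : ∀ x, |x| ≤ η → Φ x = 0)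
    (hwm : ∀ a b, 0 ≤ a → a ≤ b → b ≤ T → ∃ W : Ω → ℝ,
      IsCompensatedIntegral P N (compensator T υ) (slab a b w) W ∧ AEStronglyMeasurable[m] W P)
    {s t : ℝ} (hs : 0 ≤ s) (hst : s ≤ t) (ht : t ≤ T) {J : Ω → ℝ}
    (hJ : IsCompensatedIntegral P N (compensator T υ) (slab s t fun z => Φ (w z)) J) :
    AEStronglyMeasurable[m] J P := by
  obtain ⟨n₀, hn₀⟩ := exists_nat_one_div_lt hη
  replace h0 : ∀ x, |x| ≤ 1 / ((n₀ : ℝ) + 1) → Φ x = 0 := fun x hx => h0 x (hx.trans hn₀.le)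
  have hfin := fun n => compensator_bigJumps_lt_top (T := T) hυ n
  have hne := ae_compensator_snd_ne_zero (T := T) hυ
  have hw0 (z : ℝ) (hz : |z| ≤ 1 / ((n₀ : ℝ) + 1)) : Φ (w z) = 0 := h0 _ ((hwle z).trans hz)
  have hΦm : Measurable fun z => Φ (w z) := hΦ.continuous.measurable.comp hw
  have hint {a b : ℝ} (ha : 0 ≤ a) (hb : b ≤ T) :
      Integrable (slab a b fun z => Φ (w z)) (compensator T υ) := by
    refine integrable_slab_of_bounded ?_ hΦm (fun z => hB _) hw0
    rw [compensator_slabSet hυ ha hb]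
    exact ENNReal.mul_ne_top ENNReal.ofReal_ne_top (hυ.measure_lt_top (by positivity)).ne
  set K : Ω → ℝ := fun ω => ∫ p, slab s t (fun z => Φ (w z)) p ∂(N ω) with hK
  have hKm : AEStronglyMeasurable K P := (h.aemeasurable_integral (hint hs ht)).aestronglyMeasurable
  -- approximation by functionals of the increments
  have happrox (j : ℕ) : ∃ Z : Ω → ℝ, AEStronglyMeasurable[m] Z P ∧
      eLpNorm (fun ω => Z ω - K ω) 1 P ≤ ENNReal.ofReal (1 / ((j : ℝ) + 1) * (t - s)) := by
    obtain ⟨δ, hδ, hstep⟩ := exists_integral_abs_sub_le (T := T) (P := P) h hυ hN hw hwle hΦ hB h0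
      (ε := 1 / ((j : ℝ) + 1)) (by positivity)
    -- The inequality is strict, so k is positive even when s = t.
    obtain ⟨k, hk⟩ := exists_nat_gt ((t - s) / δ)
    have hts : 0 ≤ t - s := sub_nonneg.2 hst
    have hk0 : 0 < (k : ℝ) := lt_of_le_of_lt (by positivity) hk
    set d := (t - s) / k with hd
    have hd0 : 0 ≤ d := by positivity
    have hdδ : d ≤ δ := by
      rw [div_lt_iff₀ hδ] at hk
      rw [hd, div_le_iff₀ hk0]; linarith
    have hkd : k * d = t - s := by rw [hd]; field_simp
    let u : ℕ → ℝ := fun i => s + i * d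
    have hu : Monotone u := fun i i' hii => by
      have : (i : ℝ) ≤ i' := by exact_mod_cast hii
      simp only [u]; gcongr
    have hu0 : u 0 = s := by simp [u]
    have huk : u k = t := by simp only [u, hkd]; ring
    have hulow (i) : 0 ≤ u i := by simp only [u]; positivity
    have huup {i} (hi : i ≤ k) : u i ≤ T := (hu hi).trans (huk ▸ ht)
    have hchoose (i) : ∃ W : Ω → ℝ, i ∈ Finset.range k →
        IsCompensatedIntegral P N (compensator T υ) (slab (u i) (u (i + 1)) w) W ∧
          AEStronglyMeasurable[m] W P := by
      by_cases hi : i ∈ Finset.range k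
      · obtain ⟨W, hW⟩ := hwm (u i) (u (i + 1)) (hulow i) (hu (Nat.le_succ i))
          (huup (Finset.mem_range.1 hi))
        exact ⟨W, fun _ => hW⟩
      · exact ⟨fun _ => 0, fun h => absurd h hi⟩
    choose W hW using hchoose
    have hst' (i) (hi : i ∈ Finset.range k) := hstep (u i) (u (i + 1)) (hulow i)
      (hu (Nat.le_succ i)) (huup (Finset.mem_range.1 hi))
      (by simp only [u]; push_cast; linarith) (W i) (hW i hi).1
    have hZm (i) (hi : i ∈ Finset.range k) : AEStronglyMeasurable[m] (fun ω => Φ (W i ω)) P :=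
      hΦ.continuous.comp_aestronglyMeasurable (hW i hi).2
    refine ⟨fun ω => ∑ i ∈ Finset.range k, Φ (W i ω), ?_, ?_⟩
    · exact aestronglyMeasurable_finset_sum hZm
    set G : ℕ → Ω → ℝ := fun i ω =>
      Φ (W i ω) - ∫ p, slab (u i) (u (i + 1)) (fun z => Φ (w z)) p ∂(N ω) with hG
    have hsum : (fun ω => ∑ i ∈ Finset.range k, Φ (W i ω) - K ω) =ᵐ[P]
        fun ω => ∑ i ∈ Finset.range k, G i ω := by
      have : ∀ᵐ ω ∂P, ∀ i ∈ Finset.range k,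
          Integrable (slab (u i) (u (i + 1)) fun z => Φ (w z)) (N ω) := by
        rw [Finset.eventually_all]
        exact fun i hi => h.ae_integrable (hint (hulow i) (huup (Finset.mem_range.1 hi)))
      filter_upwards [this] with ω hω
      rw [Finset.sum_sub_distrib, ← integral_finsetSum _ hω, hK]
      simp only [sum_slab hu, hu0, huk]
    have hGi (i) (hi : i ∈ Finset.range k) : Integrable (G i) P := (hst' i hi).1
    have hi1 : Integrable (fun ω => ∑ i ∈ Finset.range k, G i ω) P := integrable_finsetSum _ hGi
    rw [eLpNorm_congr_ae hsum, eLpNorm_one_eq_lintegral_enorm,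
      ← ofReal_integral_norm_eq_lintegral_enorm hi1]
    refine ENNReal.ofReal_le_ofReal ?_
    calc ∫ ω, ‖∑ i ∈ Finset.range k, G i ω‖ ∂P
        ≤ ∫ ω, ∑ i ∈ Finset.range k, |G i ω| ∂P :=
          integral_mono hi1.norm (integrable_finsetSum _ fun i hi => (hGi i hi).abs)
            fun ω => norm_sum_le _ _
      _ = ∑ i ∈ Finset.range k, ∫ ω, |G i ω| ∂P :=
          integral_finsetSum _ fun i hi => (hGi i hi).abs
      -- The error on each piece is proportional to its length, so the total does not depend on the
      -- number of pieces.
      _ ≤ ∑ i ∈ Finset.range k, 1 / ((j : ℝ) + 1) * (u (i + 1) - u i) :=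
          Finset.sum_le_sum fun i hi => (hst' i hi).2
      _ = _ := by rw [← Finset.mul_sum, Finset.sum_range_sub, hu0, huk]
  choose Z hZm hZ using happrox
  have hKm' : AEStronglyMeasurable[m] K P := by
    refine aestronglyMeasurable_of_tendsto_eLpNorm one_ne_zero hm hZm hKm ?_
    refine tendsto_of_tendsto_of_tendsto_of_le_of_le tendsto_const_nhds ?_ (fun _ => zero_le) hZ
    have := (tendsto_one_div_add_atTop_nhds_zero_nat (𝕜 := ℝ)).mul_const (t - s)
    simpa using ENNReal.tendsto_ofReal this
  have hΦ2 : MemLp (slab s t fun z => Φ (w z)) 2 (compensator T υ) := by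
    refine (memLp_two_iff_integrable_sq (hint hs ht).1).2 ?_
    simp only [slab_sq]
    refine integrable_slab_of_bounded (n₀ := n₀) (B := B ^ 2) ?_ (hΦm.pow_const 2)
      (fun z => ?_) (fun z hz => by rw [hw0 z hz]; simp)
    · rw [compensator_slabSet hυ hs ht]
      exact ENNReal.mul_ne_top ENNReal.ofReal_ne_top (hυ.measure_lt_top (by positivity)).ne
    · rw [abs_of_nonneg (sq_nonneg _), ← sq_abs]
      gcongr
      exact hB _
  -- The integrand ignores small jumps, so its compensated integral is `K` minus a constant.
  have hJ' := isCompensatedIntegral_compInt h hfin hΦ2 n₀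
  have hind : (bigJumps n₀).indicator (slab s t fun z => Φ (w z)) = slab s t fun z => Φ (w z) := by
    rw [indicator_bigJumps_slab, ← indicator_slabSet]
    exact (slab_eq_indicator_slabSet s t le_rfl hw0).symm
  rw [hind] at hJ'
  refine AEStronglyMeasurable.congr ?_ (hJ'.ae_eq h hfin hne hΦ2 hJ)
  exact hKm'.sub aestronglyMeasurable_const

end Recover

/-! ### The function `γ` and its inverse -/

lemma gam_of_nonneg {z : ℝ} (hz : 0 ≤ z) : gam z = 1 - Real.exp (-z) := if_neg (not_lt.2 hz)

lemma gam_of_nonpos {z : ℝ} (hz : z ≤ 0) : gam z = Real.exp z - 1 := by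
  rcases hz.lt_or_eq with h | rfl
  · exact if_pos h
  · simp [gam]

lemma continuous_gam : Continuous gam := by
  have : gam = fun z => if z ≤ 0 then Real.exp z - 1 else 1 - Real.exp (-z) := by
    ext z
    split_ifs with h
    · exact gam_of_nonpos h
    · exact gam_of_nonneg (not_le.1 h).le
  rw [this]
  refine Continuous.if_le (by fun_prop) (by fun_prop) continuous_id continuous_const ?_
  rintro z rfl
  simp

lemma abs_gam (z : ℝ) : |gam z| = 1 - Real.exp (-|z|) := by
  rcases le_total 0 z with h | h
  · rw [gam_of_nonneg h, abs_of_nonneg h, abs_of_nonneg]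
    linarith [Real.exp_le_one_iff.2 (neg_nonpos.2 h)]
  · rw [gam_of_nonpos h, abs_of_nonpos h, neg_neg, abs_of_nonpos]
    · ring
    · linarith [Real.exp_le_one_iff.2 h]

lemma abs_gam_lt_one (z : ℝ) : |gam z| < 1 := by
  rw [abs_gam]; linarith [Real.exp_pos (-|z|)]

lemma abs_gam_le (z : ℝ) : |gam z| ≤ |z| := by
  rw [abs_gam]; linarith [Real.add_one_le_exp (-|z|)]

lemma gam_zero : gam 0 = 0 := by simp [gam]

/-- The inverse of `γ` on `(-1, 1)`. -/
noncomputable def gamInv (x : ℝ) : ℝ := if x ≤ 0 then Real.log (1 + x) else -Real.log (1 - x)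

lemma gamInv_zero : gamInv 0 = 0 := by simp [gamInv]

lemma gamInv_gam (z : ℝ) : gamInv (gam z) = z := by
  rcases le_or_gt z 0 with h | h
  · have h1 : gam z ≤ 0 := by
      rw [gam_of_nonpos h]; linarith [Real.exp_le_one_iff.2 h]
    rw [gamInv, if_pos h1, gam_of_nonpos h]
    simp
  · have h1 : ¬ gam z ≤ 0 := by
      rw [gam_of_nonneg h.le]; linarith [Real.exp_lt_one_iff.2 (neg_lt_zero.2 h)]
    rw [gamInv, if_neg h1, gam_of_nonneg h.le]
    simp

lemma continuousOn_gamInv : ContinuousOn gamInv (Set.Ioo (-1) 1) := by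
  unfold gamInv
  refine ContinuousOn.if (p := fun x : ℝ => x ≤ 0) ?_ ?_ ?_
  · rintro x ⟨-, hx⟩
    have : x = 0 := by
      have := frontier_le_subset_eq (f := fun x : ℝ => x) (g := fun _ => 0) continuous_id
        continuous_const hx
      simpa using this
    simp [this]
  · refine ContinuousOn.log (by fun_prop) ?_
    rintro x ⟨⟨hx, -⟩, -⟩
    linarith
  · refine (ContinuousOn.log (by fun_prop) ?_).neg
    rintro x ⟨⟨-, hx⟩, -⟩
    linarith

lemma abs_gamInv {x : ℝ} (hx : |x| < 1) : |gamInv x| = -Real.log (1 - |x|) := by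
  rcases le_or_gt x 0 with h | h
  · rw [gamInv, if_pos h, abs_of_nonpos h, sub_neg_eq_add, abs_of_nonpos]
    refine Real.log_nonpos ?_ (by linarith)
    linarith [(abs_lt.1 hx).1]
  · rw [gamInv, if_neg (not_le.2 h), abs_of_pos h, abs_of_nonneg]
    rw [neg_nonneg]
    rw [abs_of_pos h] at hx
    exact Real.log_nonpos (by linarith) (by linarith)

/-- The modulus of γ⁻¹ is an increasing function of |x|. Hence softly truncating γ(z) before
inverting keeps the result bounded by |z|. -/
lemma abs_gamInv_le_of_abs_le {x y : ℝ} (hxy : |x| ≤ |y|) (hy : |y| < 1) :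
    |gamInv x| ≤ |gamInv y| := by
  rw [abs_gamInv (hxy.trans_lt hy), abs_gamInv hy, neg_le_neg_iff]
  exact Real.log_le_log (by linarith) (by linarith)

/-! ### Soft truncation -/

/-- The truncation of a real number to `[-R, R]`. -/
def clip (R x : ℝ) : ℝ := max (-R) (min R x)

lemma lipschitzWith_clip (R : ℝ) : LipschitzWith 1 (clip R) :=
  (LipschitzWith.id.const_min R).const_max (-R)

lemma clip_of_abs_le {R x : ℝ} (h : |x| ≤ R) : clip R x = x := by
  rw [clip, min_eq_right (abs_le.1 h).2, max_eq_right (abs_le.1 h).1]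

/-- A continuous truncation of large and small values. -/
def softTrunc (η R x : ℝ) : ℝ := clip R x - clip η x

lemma uniformContinuous_softTrunc (η R : ℝ) : UniformContinuous (softTrunc η R) :=
  (lipschitzWith_clip R).uniformContinuous.sub (lipschitzWith_clip η).uniformContinuous

lemma softTrunc_of_abs_le {η R x : ℝ} (hηR : η ≤ R) (h : |x| ≤ η) : softTrunc η R x = 0 := by
  rw [softTrunc, clip_of_abs_le h, clip_of_abs_le (h.trans hηR), sub_self]

lemma abs_clip_le {η : ℝ} (hη : 0 ≤ η) (x : ℝ) : |clip η x| ≤ η := by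
  rw [abs_le]
  exact ⟨le_max_left _ _, max_le (by linarith) (min_le_left _ _)⟩

lemma clip_of_nonneg {c x : ℝ} (hc : 0 ≤ c) (hx : 0 ≤ x) : clip c x = min c x :=
  max_eq_right (by linarith [le_min hc hx])

lemma clip_of_nonpos {c x : ℝ} (hc : 0 ≤ c) (hx : x ≤ 0) : clip c x = -min c (-x) := by
  rw [clip, min_eq_right (hx.trans hc), ← max_neg_neg, neg_neg]

lemma abs_softTrunc_le {η R : ℝ} (hη : 0 ≤ η) (hηR : η ≤ R) (x : ℝ) :
    |softTrunc η R x| ≤ |x| ∧ |softTrunc η R x| ≤ R := by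
  have key {y : ℝ} (hy : 0 ≤ y) : |min R y - min η y| ≤ y ∧ |min R y - min η y| ≤ R := by
    rw [abs_of_nonneg (sub_nonneg.2 (min_le_min_right y hηR))]
    have := le_min hη hy
    constructor <;> linarith [min_le_left R y, min_le_right R y]
  rcases le_total 0 x with hx | hx
  · rw [softTrunc, clip_of_nonneg hη hx, clip_of_nonneg (hη.trans hηR) hx, abs_of_nonneg hx]
    exact key hx
  · rw [softTrunc, clip_of_nonpos hη hx, clip_of_nonpos (hη.trans hηR) hx, abs_of_nonpos hx,
      neg_sub_neg, abs_sub_comm]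
    exact key (neg_nonneg.2 hx)

lemma tendsto_softTrunc {η R : ℕ → ℝ} (hη0 : ∀ n, 0 ≤ η n) (hη : Tendsto η atTop (𝓝 0)) {x : ℝ}
    (hR : ∀ᶠ n in atTop, |x| ≤ R n) : Tendsto (fun n => softTrunc (η n) (R n) x) atTop (𝓝 x) := by
  have h1 : Tendsto (fun n => clip (η n) x) atTop (𝓝 0) :=
    squeeze_zero_norm (fun n => abs_clip_le (hη0 n) x) hη
  have h2 : Tendsto (fun n => clip (R n) x) atTop (𝓝 x) :=
    tendsto_const_nhds.congr' (hR.mono fun n hn => (clip_of_abs_le hn).symm)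
  simpa [softTrunc] using h2.sub h1

/-- The truncation takes values in [-R, R], so compactness suffices. For γ⁻¹, which blows up at ±1,
this is why one takes R < 1. -/
lemma uniformContinuous_comp_softTrunc {η R : ℝ} (hη : 0 ≤ η) (hηR : η ≤ R) {G : ℝ → ℝ}
    (hG : ContinuousOn G (Set.Icc (-R) R)) : UniformContinuous fun x => G (softTrunc η R x) := by
  have hU := isCompact_Icc.uniformContinuousOn_of_continuous hG
  rw [Metric.uniformContinuousOn_iff] at hU
  rw [Metric.uniformContinuous_iff]
  intro ε hε
  obtain ⟨δ, hδ, h⟩ := hU ε hε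
  obtain ⟨δ', hδ', h'⟩ := Metric.uniformContinuous_iff.1 (uniformContinuous_softTrunc η R) δ hδ
  exact ⟨δ', hδ', fun x y hxy => h _ (abs_le.1 (abs_softTrunc_le hη hηR _).2) _
    (abs_le.1 (abs_softTrunc_le hη hηR _).2) (h' hxy)⟩

/-! ### Measurability of compensated integrals -/

section Recover

variable {Ω : Type*} {m : MeasurableSpace Ω} [m0 : MeasurableSpace Ω] {P : Measure Ω}
  [IsProbabilityMeasure P] {N : Ω → Measure (ℝ × ℝ)} {T : ℝ} {υ : Measure ℝ}

lemma memLp_compensator_abs_snd (hυ : IsSqIntegrableLevyMeasure υ) (C : ℝ) :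
    MemLp (fun p : ℝ × ℝ => C * |p.2|) 2 (compensator T υ) :=
  memLp_compensator_mul hυ (F := fun _ => C) measurable_const (fun _ => le_rfl) hυ.memLp_id.abs

/-- If the compensated integrals of `1_{(a, b]}(t) w(z)` are almost surely `m`-measurable, so are
those of `1_{(s, t]}(t) G(w(z))`. -/
lemma aestronglyMeasurable_slab_comp_of_tendsto (hm : m ≤ m0)
    (h : IsPoissonRandomMeasure P N (compensator T υ))
    (hυ : IsSqIntegrableLevyMeasure υ) (hN : ∀ ω, IsSumDirac (N ω)) {w : ℝ → ℝ}
    (hw : Measurable w) (hwle : ∀ z, |w z| ≤ |z|)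
    (hwm : ∀ a b, 0 ≤ a → a ≤ b → b ≤ T → ∃ W : Ω → ℝ,
      IsCompensatedIntegral P N (compensator T υ) (slab a b w) W ∧ AEStronglyMeasurable[m] W P)
    {G : ℝ → ℝ} (hG0 : G 0 = 0) {η R : ℕ → ℝ} (hη0 : ∀ n, 0 < η n) (hη : Tendsto η atTop (𝓝 0))
    (hηR : ∀ n, η n ≤ R n) (hR : ∀ z, ∀ᶠ n in atTop, |w z| ≤ R n)
    (hG : ∀ n, ContinuousOn G (Set.Icc (-R n) (R n))) (hGc : ∀ z, ContinuousAt G (w z))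
    (hGle : ∀ n z, |G (softTrunc (η n) (R n) (w z))| ≤ |z|)
    {s t : ℝ} (hs : 0 ≤ s) (hst : s ≤ t) (ht : t ≤ T) {J : Ω → ℝ}
    (hJ : IsCompensatedIntegral P N (compensator T υ) (slab s t fun z => G (w z)) J) :
    AEStronglyMeasurable[m] J P := by
  have hfin := fun n => compensator_bigJumps_lt_top (T := T) hυ n
  have hne := ae_compensator_snd_ne_zero (T := T) hυ
  have hUC (n) := uniformContinuous_comp_softTrunc (hη0 n).le (hηR n) (hG n)
  -- Each approximant is a bounded, uniformly continuous function of w(z), zero near w(z) = 0. All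
  -- are dominated by |z|, which is square-integrable.
  set g : ℕ → ℝ → ℝ := fun n z => G (softTrunc (η n) (R n) (w z)) with hg
  have hgm (n) : Measurable (g n) := (hUC n).continuous.measurable.comp hw
  have hg2 (n) : MemLp (g n) 2 υ := hυ.memLp_of_abs_le (hgm n) (hGle n)
  have hslab (n) := memLp_slab (T := T) hυ s t (hg2 n)
  choose X hX using fun n => h.exists_isCompensatedIntegral hfin hne (hslab n)
  have hXm (n) : AEStronglyMeasurable[m] (X n) P := by
    obtain ⟨B, hB⟩ := isCompact_Icc.exists_bound_of_continuousOn (hG n)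
    exact aestronglyMeasurable_slab_comp hm h hυ hN hw hwle (hUC n)
      (fun x => hB _ (abs_le.1 (abs_softTrunc_le (hη0 n).le (hηR n) x).2)) (hη0 n)
      (fun x hx => by rw [softTrunc_of_abs_le (hηR n) hx, hG0]) hwm hs hst ht (hX n)
  refine aestronglyMeasurable_of_tendsto_eLpNorm two_ne_zero hm hXm hJ.memLp.1
    (IsCompensatedIntegral.tendsto_of_dominated h hfin hne (fun n => (hslab n).1)
      (memLp_compensator_abs_snd hυ 1) (fun n => ae_of_all _ fun p => ?_)
      (ae_of_all _ fun p => ?_) hX hJ)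
  · rw [slab, abs_mul]
    exact mul_le_mul (abs_indicator_one_le _ _) (hGle n _) (abs_nonneg _) zero_le_one
  · exact (((hGc p.2).tendsto.comp (tendsto_softTrunc (fun n => (hη0 n).le) hη (hR p.2)))).const_mul _

/-- If the compensated integrals of `1_{(a, b]}(t) g(z)` are almost surely `m`-measurable, so are
those of `h(t) g(z)` for continuous `h`. -/
lemma aestronglyMeasurable_mul_of_slab (hm : m ≤ m0) (hT : 0 < T)
    (h : IsPoissonRandomMeasure P N (compensator T υ))
    (hυ : IsSqIntegrableLevyMeasure υ) {g : ℝ → ℝ} (hg : Measurable g) (hgle : ∀ z, |g z| ≤ |z|)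
    (hgm : ∀ a b, 0 ≤ a → a ≤ b → b ≤ T → ∃ W : Ω → ℝ,
      IsCompensatedIntegral P N (compensator T υ) (slab a b g) W ∧ AEStronglyMeasurable[m] W P)
    {f : ℝ → ℝ} (hf : Continuous f) {C : ℝ} (hC : ∀ t, |f t| ≤ C) {J : Ω → ℝ}
    (hJ : IsCompensatedIntegral P N (compensator T υ) (fun p => f p.1 * g p.2) J) :
    AEStronglyMeasurable[m] J P := by
  have hfin := fun n => compensator_bigJumps_lt_top (T := T) hυ n
  have hne := ae_compensator_snd_ne_zero (T := T) hυ
  have hg2 := hυ.memLp_of_abs_le hg hgle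
  have hC0 : 0 ≤ C := (abs_nonneg _).trans (hC 0)
  let u : ℕ → ℕ → ℝ := fun n k => k * (T / ((n : ℝ) + 1))
  have hu (n) : Monotone (u n) := fun k k' hk => by
    have : (k : ℝ) ≤ k' := by exact_mod_cast hk
    simp only [u]; gcongr
  have hu0 (n) : u n 0 = 0 := by simp [u]
  have huT (n) : u n (n + 1) = T := by
    simp only [u]; push_cast; field_simp
  have hlow (n k) : 0 ≤ u n k := by simp only [u]; positivity
  have hup {n k} (hk : k ∈ Finset.range (n + 1)) : u n (k + 1) ≤ T :=
    (hu n (Finset.mem_range.1 hk)).trans (huT n).le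
  have hdiff (n k) : u n (k + 1) - u n k = T / ((n : ℝ) + 1) := by
    simp only [u]; push_cast; ring
  have hchoose (n k) : ∃ W : Ω → ℝ, k ∈ Finset.range (n + 1) →
      IsCompensatedIntegral P N (compensator T υ) (slab (u n k) (u n (k + 1)) g) W ∧
        AEStronglyMeasurable[m] W P := by
    by_cases hk : k ∈ Finset.range (n + 1)
    · obtain ⟨W, hW⟩ := hgm (u n k) (u n (k + 1)) (hlow n k) (hu n (Nat.le_succ k)) (hup hk)
      exact ⟨W, fun _ => hW⟩
    · exact ⟨fun _ => 0, fun h => absurd h hk⟩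
  choose W hW using hchoose
  -- Replace f by its left-endpoint step function on n + 1 equal intervals. Its integral is a
  -- combination of slab integrals.
  set F : ℕ → ℝ × ℝ → ℝ := fun n p =>
    ∑ k ∈ Finset.range (n + 1), f (u n k) * slab (u n k) (u n (k + 1)) g p with hF
  have hslab (n k) := (memLp_slab (T := T) hυ (u n k) (u n (k + 1)) hg2).const_mul (f (u n k))
  have hX (n) : IsCompensatedIntegral P N (compensator T υ) (F n)
      (fun ω => ∑ k ∈ Finset.range (n + 1), f (u n k) * W n k ω) :=
    IsCompensatedIntegral.finset_sum h hfin _ (fun k _ => hslab n k)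
      fun k hk => (hW n k hk).1.const_mul _
  have hXm (n) : AEStronglyMeasurable[m]
      (fun ω => ∑ k ∈ Finset.range (n + 1), f (u n k) * W n k ω) P :=
    aestronglyMeasurable_finset_sum fun k hk => (hW n k hk).2.const_mul _
  -- The half-open intervals partition (0, T]. The missing time 0 is a null set of the compensator.
  have hone (n) (t : ℝ) (ht : t ∈ Set.Ioc 0 T) : ∑ k ∈ Finset.range (n + 1),
      (Set.Ioc (u n k) (u n (k + 1))).indicator (fun _ => (1 : ℝ)) t = 1 := by
    have := sum_slab (hu n) (n + 1) (fun _ => 1) (t, 0)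
    simpa [slab, hu0, huT, ht.1, ht.2] using this
  have hpos : ∀ᵐ p ∂(compensator T υ), p.1 ∈ Set.Ioc 0 T := by
    refine ae_compensator_fst hυ ?_
    filter_upwards [ae_restrict_mem measurableSet_Icc,
      ae_restrict_of_ae (Measure.ae_ne volume (0 : ℝ))] with t ht ht0
    exact ⟨lt_of_le_of_ne ht.1 (Ne.symm ht0), ht.2⟩
  have hFeq (n) (p : ℝ × ℝ) : F n p = (∑ k ∈ Finset.range (n + 1), f (u n k) *
      (Set.Ioc (u n k) (u n (k + 1))).indicator (fun _ => (1 : ℝ)) p.1) * g p.2 := by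
    simp only [hF, slab, Finset.sum_mul, mul_assoc]
  have hind0 (s : Set ℝ) (t : ℝ) : 0 ≤ s.indicator (fun _ => (1 : ℝ)) t :=
    Set.indicator_nonneg (fun _ _ => zero_le_one) _
  refine aestronglyMeasurable_of_tendsto_eLpNorm two_ne_zero hm hXm hJ.memLp.1
    (IsCompensatedIntegral.tendsto_of_dominated (F := F) h hfin hne
      (fun n => (memLp_finsetSum _ fun k _ => hslab n k).1)
      (memLp_compensator_abs_snd hυ C) (fun n => ?_) ?_ hX hJ)
  · filter_upwards [hpos] with p hp
    rw [hFeq, abs_mul]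
    refine mul_le_mul ?_ (hgle _) (abs_nonneg _) hC0
    refine (Finset.abs_sum_le_sum_abs _ _).trans ?_
    calc _ ≤ ∑ k ∈ Finset.range (n + 1), C *
          (Set.Ioc (u n k) (u n (k + 1))).indicator (fun _ => (1 : ℝ)) p.1 := by
          refine Finset.sum_le_sum fun k _ => ?_
          rw [abs_mul, abs_of_nonneg (hind0 _ _)]
          exact mul_le_mul_of_nonneg_right (hC _) (hind0 _ _)
      _ = C := by rw [← Finset.mul_sum, hone n _ hp, mul_one]
  · filter_upwards [hpos] with p hp
    simp only [hFeq]
    refine Tendsto.mul_const _ ?_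
    rw [Metric.tendsto_atTop]
    intro ε hε
    obtain ⟨δ, hδ, hfδ⟩ := Metric.continuousAt_iff.1 (hf.continuousAt (x := p.1)) (ε / 2)
      (by positivity)
    have hlim : Tendsto (fun n : ℕ => T / ((n : ℝ) + 1)) atTop (𝓝 0) := by
      simpa [div_eq_mul_inv] using
        (tendsto_one_div_add_atTop_nhds_zero_nat (𝕜 := ℝ)).const_mul T
    obtain ⟨n₀, hn₀⟩ := eventually_atTop.1 (hlim.eventually_lt_const hδ)
    refine ⟨n₀, fun n hn => ?_⟩
    have e : (∑ k ∈ Finset.range (n + 1), f (u n k) *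
        (Set.Ioc (u n k) (u n (k + 1))).indicator (fun _ => (1 : ℝ)) p.1) - f p.1 =
        ∑ k ∈ Finset.range (n + 1), (f (u n k) - f p.1) *
          (Set.Ioc (u n k) (u n (k + 1))).indicator (fun _ => (1 : ℝ)) p.1 := by
      simp only [sub_mul, Finset.sum_sub_distrib, ← Finset.mul_sum, hone n _ hp, mul_one]
    rw [Real.dist_eq, e]
    calc _ ≤ ∑ k ∈ Finset.range (n + 1), ε / 2 *
          (Set.Ioc (u n k) (u n (k + 1))).indicator (fun _ => (1 : ℝ)) p.1 := by
          refine (Finset.abs_sum_le_sum_abs _ _).trans (Finset.sum_le_sum fun k _ => ?_)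
          by_cases hk : p.1 ∈ Set.Ioc (u n k) (u n (k + 1))
          · simp only [Set.indicator_of_mem hk, mul_one]
            refine (hfδ ?_).le
            rw [Real.dist_eq, abs_lt]
            constructor <;> linarith [hk.1, hk.2, hdiff n k, hn₀ n hn]
          · simp [hk]
      _ = ε / 2 := by rw [← Finset.mul_sum, hone n _ hp, mul_one]
      _ < ε := by linarith

/-- A continuous approximation of the indicator function of `(a, b]`. -/
noncomputable def ramp (a b : ℝ) (n : ℕ) (t : ℝ) : ℝ :=
  max 0 (min 1 (n * (t - a))) - max 0 (min 1 (n * (t - b)))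

lemma continuous_ramp (a b : ℝ) (n : ℕ) : Continuous (ramp a b n) := by
  unfold ramp; fun_prop

lemma abs_ramp_le (a b : ℝ) (n : ℕ) (t : ℝ) : |ramp a b n t| ≤ 1 := by
  have h (x : ℝ) : 0 ≤ max 0 (min 1 x) ∧ max 0 (min 1 x) ≤ 1 :=
    ⟨le_max_left _ _, max_le zero_le_one (min_le_left _ _)⟩
  rw [ramp, abs_le]
  constructor <;> linarith [(h (n * (t - a))).1, (h (n * (t - a))).2, (h (n * (t - b))).1,
    (h (n * (t - b))).2]

lemma tendsto_ramp {a b : ℝ} (hab : a ≤ b) (t : ℝ) :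
    Tendsto (fun n => ramp a b n t) atTop
      (𝓝 ((Set.Ioc a b).indicator (fun _ => (1 : ℝ)) t)) := by
  have h1 {c : ℝ} (hc : t ≤ c) (n : ℕ) : max 0 (min 1 (n * (t - c))) = 0 :=
    max_eq_left ((min_le_right _ _).trans
      (mul_nonpos_of_nonneg_of_nonpos (Nat.cast_nonneg n) (by linarith)))
  have h2 {c : ℝ} (hc : c < t) : ∀ᶠ n : ℕ in atTop, max 0 (min 1 (n * (t - c))) = 1 := by
    obtain ⟨k, hk⟩ := exists_nat_gt (1 / (t - c))
    filter_upwards [eventually_ge_atTop k] with n hn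
    have hn' : (k : ℝ) ≤ n := by exact_mod_cast hn
    have hpos : 0 < t - c := by linarith
    rw [div_lt_iff₀ hpos] at hk
    rw [min_eq_left (by nlinarith), max_eq_right zero_le_one]
  refine tendsto_const_nhds.congr' ?_
  rcases le_or_gt t a with ha | ha
  · refine Eventually.of_forall fun n => ?_
    simp [ramp, h1 ha, h1 (ha.trans hab), not_lt.2 ha]
  · rcases le_or_gt t b with hb | hb
    · filter_upwards [h2 ha] with n hn
      rw [ramp, h1 hb, hn]
      simp [ha, hb]
    · filter_upwards [h2 ha, h2 hb] with n hn hn'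
      simp [ramp, hn, hn', not_le.2 hb]

/-- If the compensated integrals of `f(t) g(z)` are almost surely `m`-measurable for continuous
`f`, so are those of `1_{(a, b]}(t) g(z)`. -/
lemma aestronglyMeasurable_slab_of_mul (hm : m ≤ m0)
    (h : IsPoissonRandomMeasure P N (compensator T υ))
    (hυ : IsSqIntegrableLevyMeasure υ) {g : ℝ → ℝ} (hg : Measurable g) (hgle : ∀ z, |g z| ≤ |z|)
    (hgm : ∀ f : ℝ → ℝ, Continuous f → ∃ W : Ω → ℝ,
      IsCompensatedIntegral P N (compensator T υ) (fun p => f p.1 * g p.2) W ∧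
        AEStronglyMeasurable[m] W P)
    {a b : ℝ} (hab : a ≤ b) {J : Ω → ℝ}
    (hJ : IsCompensatedIntegral P N (compensator T υ) (slab a b g) J) :
    AEStronglyMeasurable[m] J P := by
  have hfin := fun n => compensator_bigJumps_lt_top (T := T) hυ n
  have hne := ae_compensator_snd_ne_zero (T := T) hυ
  have hg2 := hυ.memLp_of_abs_le hg hgle
  choose X hX hXm using fun n => hgm (ramp a b n) (continuous_ramp a b n)
  refine aestronglyMeasurable_of_tendsto_eLpNorm two_ne_zero hm hXm hJ.memLp.1
    (IsCompensatedIntegral.tendsto_of_dominated h hfin hne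
      (fun n => (memLp_compensator_mul hυ (continuous_ramp a b n).measurable
        (abs_ramp_le a b n) hg2).1)
      (memLp_compensator_abs_snd hυ 1) (fun n => ae_of_all _ fun p => ?_)
      (ae_of_all _ fun p => (tendsto_ramp hab p.1).mul_const _) hX hJ)
  rw [abs_mul]
  exact mul_le_mul (abs_ramp_le a b n _) (hgle _) (abs_nonneg _) zero_le_one

end Recover

/-! ### Exponential moments of compensated integrals -/

lemma exp_sub_one_sub_nonneg (x : ℝ) : 0 ≤ Real.exp x - 1 - x := by
  linarith [Real.add_one_le_exp x]

lemma exp_sub_one_sub_le (x : ℝ) : Real.exp x - 1 - x ≤ Real.exp |x| * x ^ 2 := by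
  have h1 : Real.exp x - 1 ≤ x * Real.exp x := by
    have h := mul_le_mul_of_nonneg_right (Real.one_sub_le_exp_neg x) (Real.exp_pos x).le
    rw [← Real.exp_add, neg_add_cancel, Real.exp_zero] at h
    linarith
  have h2 : x * (Real.exp x - 1) ≤ |x| * (|x| * Real.exp |x|) := by
    refine (le_abs_self _).trans ?_
    rw [abs_mul]
    exact mul_le_mul_of_nonneg_left (Real.abs_exp_sub_one_le_mul_exp_abs x) (abs_nonneg x)
  rw [← sq_abs]
  linarith

lemma integrable_exp_sub_one_sub {α : Type*} [MeasurableSpace α] {μ : Measure α} {F : α → ℝ}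
    {M : ℝ} (hF : MemLp F 2 μ) (hM : ∀ x, |F x| ≤ M) :
    Integrable (fun x => Real.exp (F x) - 1 - F x) μ := by
  refine (hF.integrable_sq.const_mul (Real.exp M)).mono'
    (((Real.continuous_exp.comp_aestronglyMeasurable hF.1).sub aestronglyMeasurable_const).sub
      hF.1) (ae_of_all _ fun x => ?_)
  rw [Real.norm_of_nonneg (exp_sub_one_sub_nonneg _)]
  refine (exp_sub_one_sub_le _).trans ?_
  gcongr
  exact hM x

section ExpMoments

variable {Ω : Type*} [MeasurableSpace Ω] {P : Measure Ω} [IsProbabilityMeasure P]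
  {N : Ω → Measure (ℝ × ℝ)} {π : Measure (ℝ × ℝ)} {F : ℝ × ℝ → ℝ} {I : Ω → ℝ}

/-- Fatou's lemma along an almost surely convergent subsequence of truncations. Since e^x - 1 - x ≥
0 and vanishes at 0, truncating F only lowers the exponent on the right, so one bound serves every
level. -/
lemma IsCompensatedIntegral.lintegral_exp_le (h : IsPoissonRandomMeasure P N π)
    (hfin : ∀ n, π (bigJumps n) < ∞) (hm : Measurable F) (hF : MemLp F 2 π) {M : ℝ}
    (hM : ∀ x, |F x| ≤ M) (hI : IsCompensatedIntegral P N π F I) :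
    ∫⁻ ω, ENNReal.ofReal (Real.exp (I ω)) ∂P ≤
      ENNReal.ofReal (Real.exp (∫ x, (Real.exp (F x) - 1 - F x) ∂π)) := by
  obtain ⟨ns, -, hns⟩ := (tendstoInMeasure_of_tendsto_eLpNorm two_ne_zero
    (fun n => (memLp_truncatedIntegral h hfin hF n).1) hI.memLp.1 hI.tendsto).exists_seq_tendsto_ae
  have hbound (n) : ∫⁻ ω, ENNReal.ofReal (Real.exp (truncatedIntegral N π F n ω)) ∂P ≤
      ENNReal.ofReal (Real.exp (∫ x, (Real.exp (F x) - 1 - F x) ∂π)) := by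
    have hle (x) : |(bigJumps n).indicator F x| ≤ M := by
      by_cases hx : x ∈ bigJumps n
      · simpa [hx] using hM x
      · simpa [hx] using (abs_nonneg _).trans (hM x)
    rw [truncatedIntegral_eq]
    refine (h.lintegral_exp_compInt_le (hm.indicator (measurableSet_bigJumps n))
      (integrable_indicator_bigJumps hfin hF n) hle).trans ?_
    refine ENNReal.ofReal_le_ofReal (Real.exp_le_exp.2 (integral_mono
      (integrable_exp_sub_one_sub (memLp_indicator_bigJumps hF n) hle)
      (integrable_exp_sub_one_sub hF hM) fun x => ?_))
    by_cases hx : x ∈ bigJumps n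
    · simp [hx]
    · simpa [hx] using exp_sub_one_sub_nonneg (F x)
  calc ∫⁻ ω, ENNReal.ofReal (Real.exp (I ω)) ∂P
      = ∫⁻ ω, liminf (fun k => ENNReal.ofReal
          (Real.exp (truncatedIntegral N π F (ns k) ω))) atTop ∂P := by
        refine lintegral_congr_ae ?_
        filter_upwards [hns] with ω hω
        exact (ENNReal.tendsto_ofReal
          ((Real.continuous_exp.tendsto _).comp hω)).liminf_eq.symm
    _ ≤ liminf (fun k => ∫⁻ ω, ENNReal.ofReal
          (Real.exp (truncatedIntegral N π F (ns k) ω)) ∂P) atTop :=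
        lintegral_liminf_le' fun k => (Real.measurable_exp.comp_aemeasurable
          (memLp_truncatedIntegral h hfin hF (ns k)).1.aemeasurable).ennreal_ofReal
    _ ≤ _ := liminf_le_of_le (by isBoundedDefault) fun b hb => by
        obtain ⟨k, hk⟩ := hb.exists
        exact hk.trans (hbound _)

/-- The square of exp(I) is the exponential of the compensated integral of 2F, which is bounded as
well. -/
lemma IsCompensatedIntegral.memLp_exp (h : IsPoissonRandomMeasure P N π)
    (hfin : ∀ n, π (bigJumps n) < ∞) (hm : Measurable F) (hF : MemLp F 2 π) {M : ℝ}
    (hM : ∀ x, |F x| ≤ M) (hI : IsCompensatedIntegral P N π F I) :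
    MemLp (fun ω => Real.exp (I ω)) 2 P := by
  have hmeas : AEStronglyMeasurable (fun ω => Real.exp (I ω)) P :=
    Real.continuous_exp.comp_aestronglyMeasurable hI.memLp.1
  rw [memLp_two_iff_integrable_sq hmeas]
  refine ⟨hmeas.pow 2, ?_⟩
  rw [hasFiniteIntegral_iff_ofReal (ae_of_all _ fun _ => sq_nonneg _)]
  have hM' (x) : |2 * F x| ≤ 2 * M := by
    rw [abs_mul, abs_two]; linarith [hM x]
  refine lt_of_le_of_lt (le_of_eq ?_) (((hI.const_mul 2).lintegral_exp_le h hfin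
    (hm.const_mul 2) (hF.const_mul 2) hM').trans_lt ENNReal.ofReal_lt_top)
  refine lintegral_congr fun ω => ?_
  rw [← Real.exp_nat_mul]
  norm_num

end ExpMoments

/-! ### The integrands h(t)γ(z) -/

lemma exists_continuous_bounded_eqOn {T : ℝ} (hT : 0 ≤ T) {h : ℝ → ℝ}
    (hh : ContinuousOn h (Set.Icc 0 T)) :
    ∃ (f : ℝ → ℝ) (C : ℝ), Continuous f ∧ (∀ t, |f t| ≤ C) ∧ Set.EqOn f h (Set.Icc 0 T) := by
  obtain ⟨C, hC⟩ := isCompact_Icc.exists_bound_of_continuousOn hh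
  exact ⟨Set.IccExtend hT ((Set.Icc 0 T).domRestrict h), C, hh.domRestrict.Icc_extend',
    fun t => hC _ (Subtype.mem _), fun t ht => by simp [Set.IccExtend_of_mem hT _ ht]⟩

lemma ae_compensator_eq_of_eqOn {T : ℝ} {υ : Measure ℝ} (hυ : IsSqIntegrableLevyMeasure υ)
    {f h : ℝ → ℝ} (hfh : Set.EqOn f h (Set.Icc 0 T)) :
    ∀ᵐ p ∂(compensator T υ), f p.1 = h p.1 :=
  ae_compensator_fst hυ ((ae_restrict_mem measurableSet_Icc).mono hfh)

lemma isSumDirac_jumpMeasure (T : ℝ) (x : ℝ → ℝ) : IsSumDirac (jumpMeasure T x) := ⟨_, _, rfl⟩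

lemma memLp_compensator_gam {T : ℝ} {υ : Measure ℝ} (hυ : IsSqIntegrableLevyMeasure υ)
    {f : ℝ → ℝ} (hf : Continuous f) {C : ℝ} (hC : ∀ t, |f t| ≤ C) :
    MemLp (fun p => f p.1 * gam p.2) 2 (compensator T υ) :=
  memLp_compensator_mul hυ hf.measurable hC (hυ.memLp_of_abs_le continuous_gam.measurable abs_gam_le)

lemma abs_mul_gam_le {f : ℝ → ℝ} {C : ℝ} (hC : ∀ t, |f t| ≤ C) (p : ℝ × ℝ) :
    |f p.1 * gam p.2| ≤ C := by
  rw [abs_mul]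
  exact (mul_le_of_le_one_right (abs_nonneg _) (abs_gam_lt_one _).le).trans (hC _)

/-! ### Passing between L and the integrals of h(t)γ(z) -/

namespace IsPoissonJumpProcess

variable {Ω : Type*} {m : MeasurableSpace Ω} [m0 : MeasurableSpace Ω] {P : Measure Ω} {T : ℝ} {υ : Measure ℝ}
  {L : ℝ → Ω → ℝ}

lemma sigmaL_le (hL : IsPoissonJumpProcess P T υ L) : sigmaL T L ≤ m0 :=
  iSup₂_le fun t ht => (hL.measurable t ht).comap_le

omit m0 in
lemma measurable_sigmaL {t : ℝ} (ht : t ∈ Set.Icc 0 T) : Measurable[sigmaL T L] (L t) :=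
  Measurable.mono (comap_measurable (L t))
    (le_iSup₂_of_le (f := fun t _ => MeasurableSpace.comap (L t) inferInstance) t ht le_rfl) le_rfl

variable [IsProbabilityMeasure P]

lemma isCompensatedIntegral_slab_id (hL : IsPoissonJumpProcess P T υ L) {a b : ℝ} (ha : 0 ≤ a)
    (hab : a ≤ b) (hb : b ≤ T) :
    IsCompensatedIntegral P (fun ω => jumpMeasure T (fun t => L t ω)) (compensator T υ)
      (slab a b fun z => z) (fun ω => L b ω - L a ω) := by
  have hυ := hL.levyMeasure
  have hmem (t : ℝ) : MemLp (fun p : ℝ × ℝ => (Set.Icc 0 t).indicator (fun _ => p.2) p.1) 2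
      (compensator T υ) := by
    have := memLp_compensator_mul (T := T) hυ (F := (Set.Icc 0 t).indicator fun _ => (1 : ℝ))
      (measurable_const.indicator measurableSet_Icc) (abs_indicator_one_le _) hυ.memLp_id
    convert this using 2 with p
    simp [Set.indicator_apply]
  refine IsCompensatedIntegral.congr_left hL.poisson (((hL.eq_integral b ⟨ha.trans hab, hb⟩).sub
    hL.poisson (fun n => compensator_bigJumps_lt_top hυ n) (hmem b) (hmem a)
    (hL.eq_integral a ⟨ha, hab.trans hb⟩))) ?_
  filter_upwards [ae_compensator_fst hυ (ae_restrict_mem measurableSet_Icc)] with p hp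
  simp only [slab, Set.indicator_apply, Set.mem_Icc, Set.mem_Ioc, hp.1, true_and]
  split_ifs <;> grind

/-- Increments of L are slab integrals of the identity. Exchanging jump sizes with G = γ gives the
slab integrals of γ, and step functions in time give the rest. -/
lemma aestronglyMeasurable_mul_gam (hL : IsPoissonJumpProcess P T υ L) (hT : 0 < T)
    {f : ℝ → ℝ} (hf : Continuous f) {C : ℝ} (hC : ∀ t, |f t| ≤ C) {J : Ω → ℝ}
    (hJ : IsCompensatedIntegral P (fun ω => jumpMeasure T (fun t => L t ω)) (compensator T υ)
      (fun p => f p.1 * gam p.2) J) :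
    AEStronglyMeasurable[sigmaL T L] J P := by
  have hυ := hL.levyMeasure
  refine aestronglyMeasurable_mul_of_slab hL.sigmaL_le hT hL.poisson hυ continuous_gam.measurable
    abs_gam_le (fun a b ha hab hb => ?_) hf hC hJ
  obtain ⟨W, hW⟩ := hL.poisson.exists_isCompensatedIntegral
    (fun n => compensator_bigJumps_lt_top hυ n) (ae_compensator_snd_ne_zero hυ)
    (memLp_slab (T := T) hυ a b (hυ.memLp_of_abs_le continuous_gam.measurable abs_gam_le))
  refine ⟨W, hW, ?_⟩
  have h01 (n : ℕ) : 1 / ((n : ℝ) + 1) ≤ n + 1 := by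
    rw [div_le_iff₀ (by positivity)]
    nlinarith [Nat.cast_nonneg (α := ℝ) n]
  refine aestronglyMeasurable_slab_comp_of_tendsto hL.sigmaL_le hL.poisson hυ
    (fun ω => isSumDirac_jumpMeasure _ _) (w := fun z => z) measurable_id (fun _ => le_rfl)
    (fun a b ha hab hb => ⟨_, hL.isCompensatedIntegral_slab_id ha hab hb, ?_⟩) gam_zero
    (η := fun n : ℕ => 1 / ((n : ℝ) + 1)) (R := fun n : ℕ => (n : ℝ) + 1)
    (fun n => by positivity) tendsto_one_div_add_atTop_nhds_zero_nat h01 (fun z => ?_)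
    (fun n => continuous_gam.continuousOn) (fun z => continuous_gam.continuousAt)
    (fun n z => (abs_gam_le _).trans (abs_softTrunc_le (by positivity) (h01 n) z).1) ha hab hb hW
  · exact ((measurable_sigmaL ⟨ha.trans hab, hb⟩).sub
      (measurable_sigmaL ⟨ha, hab.trans hb⟩)).aestronglyMeasurable
  · exact (tendsto_natCast_atTop_atTop.atTop_add tendsto_const_nhds).eventually_ge_atTop _

/-- If the compensated integrals of `f(t) γ(z)` are almost surely `m`-measurable for continuous
`f`, so are the random variables `L_t`. -/
lemma aestronglyMeasurable_of_mul_gam (hL : IsPoissonJumpProcess P T υ L) (hm : m ≤ m0)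
    (hgm : ∀ f : ℝ → ℝ, Continuous f → ∃ W : Ω → ℝ,
      IsCompensatedIntegral P (fun ω => jumpMeasure T (fun t => L t ω)) (compensator T υ)
        (fun p => f p.1 * gam p.2) W ∧ AEStronglyMeasurable[m] W P)
    {t : ℝ} (ht : t ∈ Set.Icc 0 T) : AEStronglyMeasurable[m] (L t) P := by
  have hυ := hL.levyMeasure
  -- Write z as γ⁻¹(γ(z)). Passing from [0, t] to (0, t] changes the integrand only on a null set.
  have hJ : IsCompensatedIntegral P (fun ω => jumpMeasure T (fun t => L t ω)) (compensator T υ)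
      (slab 0 t fun z => gamInv (gam z)) (L t) := by
    refine (hL.eq_integral t ht).congr_left hL.poisson ?_
    filter_upwards [ae_compensator_fst hυ (ae_restrict_mem measurableSet_Icc),
      ae_compensator_fst hυ (ae_restrict_of_ae (Measure.ae_ne volume (0 : ℝ)))] with p hp hp0
    have : 0 < p.1 := lt_of_le_of_ne hp.1 (Ne.symm hp0)
    simp [slab, Set.indicator_apply, gamInv_gam, hp.1, this]
  -- The levels η = 1 / (n + 2) and R = 1 - η satisfy η ≤ R because η ≤ 1 / 2, and R stays below 1,
  -- where γ⁻¹ is continuous.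
  have hr (n : ℕ) : 0 < 1 / ((n : ℝ) + 1 + 1) ∧ 1 / ((n : ℝ) + 1 + 1) ≤ 1 / 2 := by
    refine ⟨by positivity, one_div_le_one_div_of_le two_pos ?_⟩
    linarith [Nat.cast_nonneg (α := ℝ) n]
  have hr0 : Tendsto (fun n : ℕ => 1 / ((n : ℝ) + 1 + 1)) atTop (𝓝 0) := by
    simpa using (tendsto_add_atTop_iff_nat 1).2 (tendsto_one_div_add_atTop_nhds_zero_nat (𝕜 := ℝ))
  refine aestronglyMeasurable_slab_comp_of_tendsto hm hL.poisson hυ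
    (fun ω => isSumDirac_jumpMeasure _ _) (w := gam) continuous_gam.measurable abs_gam_le
    (fun a b ha hab hb => ?_) gamInv_zero
    (η := fun n : ℕ => 1 / ((n : ℝ) + 1 + 1)) (R := fun n : ℕ => 1 - 1 / ((n : ℝ) + 1 + 1))
    (fun n => (hr n).1) hr0 (fun n => by linarith [(hr n).2]) (fun z => ?_)
    (fun n => continuousOn_gamInv.mono fun x hx =>
      ⟨by linarith [hx.1, (hr n).1], by linarith [hx.2, (hr n).1]⟩)
    (fun z => continuousOn_gamInv.continuousAt
      (Ioo_mem_nhds (abs_lt.1 (abs_gam_lt_one z)).1 (abs_lt.1 (abs_gam_lt_one z)).2))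
    (fun n z => ?_) le_rfl ht.1 ht.2 hJ
  · obtain ⟨W, hW⟩ := hL.poisson.exists_isCompensatedIntegral
      (fun n => compensator_bigJumps_lt_top hυ n) (ae_compensator_snd_ne_zero hυ)
      (memLp_slab (T := T) hυ a b (hυ.memLp_of_abs_le continuous_gam.measurable abs_gam_le))
    exact ⟨W, hW, aestronglyMeasurable_slab_of_mul hm hL.poisson hυ continuous_gam.measurable
      abs_gam_le hgm hab hW⟩
  · have : Tendsto (fun n : ℕ => 1 - 1 / ((n : ℝ) + 1 + 1)) atTop (𝓝 1) := by
      simpa using hr0.const_sub 1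
    exact (this.eventually_const_lt (abs_gam_lt_one z)).mono fun n hn => hn.le
  · have := abs_gamInv_le_of_abs_le (abs_softTrunc_le (R := 1 - 1 / ((n : ℝ) + 1 + 1)) (hr n).1.le (by linarith [(hr n).2])
      (gam z)).1 (abs_gam_lt_one z)
    rwa [gamInv_gam] at this

end IsPoissonJumpProcess

/-! ### Families of random variables with exponential moments -/

section Laplace

variable {Ω ι : Type*} [MeasurableSpace Ω] {μ ν : Measure Ω} [IsFiniteMeasure μ]
  [IsFiniteMeasure ν]

/-- A moment generating function finite on all of ℝ continues analytically to ℂ, and so determines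
the characteristic function. The masses are not normalised; the value at 0 shows that they vanish
together. -/
lemma map_eq_of_mgf_eq {Z : Ω → ℝ} (hZ : Measurable Z)
    (hint : ∀ t, Integrable (fun ω => Real.exp (t * Z ω)) μ) (hmgf : mgf Z μ = mgf Z ν) :
    μ.map Z = ν.map Z := by
  refine Measure.ext_of_complexMGF_eq hZ.aemeasurable hZ.aemeasurable ?_
  have h0 : μ = 0 ↔ ν = 0 := by
    have := congrFun hmgf 0
    simp only [mgf, zero_mul, Real.exp_zero, integral_const, smul_eq_mul, mul_one] at this
    rw [← Measure.measure_univ_eq_zero, ← measureReal_eq_zero_iff, this, measureReal_eq_zero_iff,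
      Measure.measure_univ_eq_zero]
  have huniv : integrableExpSet Z μ = Set.univ := Set.eq_univ_of_forall hint
  have := eqOn_complexMGF_of_mgf' hmgf h0
  rw [huniv, interior_univ] at this
  exact funext fun z => this (Set.mem_univ z.re)

/-- The Cramér–Wold device: every continuous linear functional on `ι → ℝ` is such a combination of
coordinates. -/
lemma map_pi_eq_of_forall_map_sum_eq [Fintype ι] {V : Ω → ι → ℝ} (hV : Measurable V)
    (h : ∀ c : ι → ℝ, μ.map (fun ω => ∑ i, c i * V ω i) = ν.map (fun ω => ∑ i, c i * V ω i)) :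
    μ.map V = ν.map V := by
  classical
  have : IsFiniteMeasure (μ.map V) := inferInstance
  have : IsFiniteMeasure (ν.map V) := inferInstance
  refine Measure.ext_of_charFunDual (funext fun l => ?_)
  have hl (x : ι → ℝ) : l x = ∑ i, l (Pi.single i 1) * x i := by
    conv_lhs => rw [pi_eq_sum_univ' x]
    simp [mul_comm]
  rw [charFunDual_eq_charFun_map_one, charFunDual_eq_charFun_map_one,
    Measure.map_map l.continuous.measurable hV, Measure.map_map l.continuous.measurable hV]
  have e : l ∘ V = fun ω => ∑ i, l (Pi.single i 1) * V ω i := funext fun ω => hl _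
  rw [e, h]

/-- The index set may be uncountable: a finite measure on the product is determined by its
finite-dimensional marginals, by uniqueness of projective limits. -/
lemma map_eq_of_forall_integral_exp_eq {J : ι → Ω → ℝ} (hJ : ∀ i, Measurable (J i))
    (hint : ∀ (s : Finset ι) (c : ι → ℝ),
      Integrable (fun ω => Real.exp (∑ i ∈ s, c i * J i ω)) μ)
    (heq : ∀ (s : Finset ι) (c : ι → ℝ),
      ∫ ω, Real.exp (∑ i ∈ s, c i * J i ω) ∂μ = ∫ ω, Real.exp (∑ i ∈ s, c i * J i ω) ∂ν) :
    μ.map (fun ω i => J i ω) = ν.map (fun ω i => J i ω) := by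
  classical
  have hm : Measurable fun ω i => J i ω := measurable_pi_iff.2 hJ
  have hfin (s : Finset ι) : μ.map (fun ω => s.restrict fun i => J i ω) =
      ν.map (fun ω => s.restrict fun i => J i ω) := by
    refine map_pi_eq_of_forall_map_sum_eq (measurable_pi_iff.2 fun i => hJ i) fun c => ?_
    let c' : ι → ℝ := fun i => if hi : i ∈ s then c ⟨i, hi⟩ else 0
    have e (t : ℝ) (ω) : t * ∑ i : s, c i * s.restrict (fun i => J i ω) i =
        ∑ i ∈ s, t * c' i * J i ω := by
      rw [Finset.mul_sum, ← Finset.sum_coe_sort s]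
      refine Finset.sum_congr rfl fun i _ => ?_
      simp [c', mul_assoc]
    refine map_eq_of_mgf_eq ?_ (fun t => ?_) (funext fun t => ?_)
    · exact Finset.measurable_fun_sum _ fun i _ => (hJ i).const_mul _
    · simpa only [e] using hint s fun i => t * c' i
    · simpa only [mgf, e] using heq s fun i => t * c' i
  have h1 := isProjectiveLimit_map (P := μ) (X := J) hm.aemeasurable
  have h2 := isProjectiveLimit_map (P := ν) (X := J) hm.aemeasurable
  simp_rw [← hfin] at h2
  exact h1.unique h2

-- The measures with densities X⁺ and X⁻ are finite and assign the same integral to each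
-- exponential, so they give the family J the same law. Evaluating on the preimage of a measurable
-- set gives the claim.
omit [IsFiniteMeasure μ] in
lemma setIntegral_eq_zero_of_forall_integral_mul_exp_eq_zero {J : ι → Ω → ℝ}
    (hJ : ∀ i, Measurable (J i)) {X : Ω → ℝ} (hX : Integrable X μ)
    (hint : ∀ (s : Finset ι) (c : ι → ℝ),
      Integrable (fun ω => X ω * Real.exp (∑ i ∈ s, c i * J i ω)) μ)
    (hzero : ∀ (s : Finset ι) (c : ι → ℝ), ∫ ω, X ω * Real.exp (∑ i ∈ s, c i * J i ω) ∂μ = 0)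
    {A : Set Ω} (hA : MeasurableSet[MeasurableSpace.comap (fun ω i => J i ω) inferInstance] A) :
    ∫ ω in A, X ω ∂μ = 0 := by
  have hm : Measurable fun ω i => J i ω := measurable_pi_iff.2 hJ
  have hd {Z : Ω → ℝ} (hZ : Integrable Z μ) :
      IsFiniteMeasure (μ.withDensity fun ω => ENNReal.ofReal (Z ω)) :=
    isFiniteMeasure_withDensity_ofReal hZ.2
  have := hd hX
  have := hd hX.neg
  have hi {Z : Ω → ℝ} (hZ : Integrable Z μ) {g : Ω → ℝ} (hg : Measurable g)
      (hZg : Integrable (fun ω => Z ω * g ω) μ) :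
      Integrable (fun ω => (ENNReal.ofReal (Z ω)).toReal • g ω) μ := by
    refine hZg.mono ((hZ.1.aemeasurable.ennreal_ofReal.ennreal_toReal.smul
      hg.aemeasurable).aestronglyMeasurable) (ae_of_all _ fun ω => ?_)
    rw [norm_smul, norm_mul]
    refine mul_le_mul_of_nonneg_right ?_ (norm_nonneg _)
    rw [ENNReal.toReal_ofReal', Real.norm_eq_abs, Real.norm_eq_abs,
      abs_of_nonneg (le_max_right _ _)]
    exact max_le (le_abs_self _) (abs_nonneg _)
  have hexp (s : Finset ι) (c : ι → ℝ) : Measurable fun ω => Real.exp (∑ i ∈ s, c i * J i ω) :=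
    (Finset.measurable_fun_sum _ fun i _ => (hJ i).const_mul _).exp
  have hneg (s : Finset ι) (c : ι → ℝ) :
      Integrable (fun ω => (-X) ω * Real.exp (∑ i ∈ s, c i * J i ω)) μ := by
    simpa [neg_mul] using (hint s c).neg
  have key : (μ.withDensity fun ω => ENNReal.ofReal (X ω)).map (fun ω i => J i ω) =
      (μ.withDensity fun ω => ENNReal.ofReal ((-X) ω)).map (fun ω i => J i ω) := by
    refine map_eq_of_forall_integral_exp_eq hJ (fun s c => ?_) fun s c => ?_
    · exact (integrable_withDensity_iff_integrable_smul₀' hX.1.aemeasurable.ennreal_ofReal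
        (ae_of_all _ fun _ => ENNReal.ofReal_lt_top)).2 (hi hX (hexp s c) (hint s c))
    · rw [integral_withDensity_eq_integral_toReal_smul₀ hX.1.aemeasurable.ennreal_ofReal
          (ae_of_all _ fun _ => ENNReal.ofReal_lt_top),
        integral_withDensity_eq_integral_toReal_smul₀ hX.neg.1.aemeasurable.ennreal_ofReal
          (ae_of_all _ fun _ => ENNReal.ofReal_lt_top), ← sub_eq_zero,
        ← integral_sub (hi hX (hexp s c) (hint s c)) (hi hX.neg (hexp s c) (hneg s c)),
        ← hzero s c]
      refine integral_congr_ae (ae_of_all _ fun ω => ?_)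
      simp only [smul_eq_mul, ENNReal.toReal_ofReal', Pi.neg_apply, ← sub_mul]
      rw [max_zero_sub_max_neg_zero_eq_self]
  obtain ⟨B, hB, rfl⟩ := hA
  have hB' := hm hB
  have e := congrArg (fun M => M B) key
  simp only [Measure.map_apply hm hB, withDensity_apply _ hB', Pi.neg_apply] at e
  rw [integral_eq_lintegral_pos_part_sub_lintegral_neg_part hX.integrableOn, e, sub_self]

end Laplace

/-! ### Almost sure measurability -/

/-- Each set of `m` agrees almost everywhere with one of `m'`. Indicators, simple functions and then
limits inherit this. -/
lemma aestronglyMeasurable_of_le_eventuallyMeasurableSpace {Ω : Type*}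
    {m m' m0 : MeasurableSpace Ω} {P : Measure Ω} (hm : m ≤ eventuallyMeasurableSpace m' (ae P))
    {X : Ω → ℝ} (hX : AEStronglyMeasurable[m] X P) : AEStronglyMeasurable[m'] X P := by
  have hsimple (g : @SimpleFunc Ω m ℝ) : AEStronglyMeasurable[m'] g P := by
    induction g using SimpleFunc.induction with
    | @const c s hs =>
      obtain ⟨t, ht, hst⟩ := hm s hs
      refine ⟨t.indicator fun _ => c, stronglyMeasurable_const.indicator ht, ?_⟩
      simp only [SimpleFunc.const_zero, SimpleFunc.coe_piecewise, SimpleFunc.coe_const,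
        SimpleFunc.coe_zero, Set.piecewise_eq_indicator]
      exact indicator_ae_eq_of_ae_eq_set hst
    | @add f g _ hf hg => exact hf.add hg
  exact AEStronglyMeasurable.congr (aestronglyMeasurable_of_ae_tendsto
    (fun n => hsimple (hX.stronglyMeasurable_mk.approx n))
    (ae_of_all _ hX.stronglyMeasurable_mk.tendsto_approx)) hX.ae_eq_mk.symm

/-! ### The exponentials and their orthogonal complement -/

namespace IsPoissonJumpProcess

variable {Ω : Type*} [m0 : MeasurableSpace Ω] {P : Measure Ω} {T : ℝ} {υ : Measure ℝ}
  {L : ℝ → Ω → ℝ} {h : ℝ → ℝ}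

/-- On `[0, T]` the continuous function `h` may be replaced by one that is bounded and continuous
on the whole line. -/
lemma exists_continuous_bounded_ae_eq (hL : IsPoissonJumpProcess P T υ L) (hT : 0 ≤ T)
    (hh : ContinuousOn h (Set.Icc 0 T)) :
    ∃ (f : ℝ → ℝ) (C : ℝ), Continuous f ∧ (∀ t, |f t| ≤ C) ∧
      ∀ᵐ p ∂(compensator T υ), f p.1 = h p.1 := by
  obtain ⟨f, C, hf, hC, hfh⟩ := exists_continuous_bounded_eqOn hT hh
  exact ⟨f, C, hf, hC, ae_compensator_eq_of_eqOn hL.levyMeasure hfh⟩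

lemma memLp_mul_gam (hL : IsPoissonJumpProcess P T υ L) (hT : 0 ≤ T)
    (hh : ContinuousOn h (Set.Icc 0 T)) :
    MemLp (fun p => h p.1 * gam p.2) 2 (compensator T υ) := by
  obtain ⟨f, C, hf, hC, hfh⟩ := hL.exists_continuous_bounded_ae_eq hT hh
  refine (memLp_congr_ae ?_).1 (memLp_compensator_gam hL.levyMeasure hf hC)
  filter_upwards [hfh] with p hp
  rw [hp]

lemma integrable_expCorrection (hL : IsPoissonJumpProcess P T υ L) (hT : 0 ≤ T)
    (hh : ContinuousOn h (Set.Icc 0 T)) : Integrable (expCorrection h) (compensator T υ) := by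
  obtain ⟨f, C, hf, hC, hfh⟩ := hL.exists_continuous_bounded_ae_eq hT hh
  refine (integrable_exp_sub_one_sub (memLp_compensator_gam hL.levyMeasure hf hC)
    (abs_mul_gam_le hC)).congr ?_
  filter_upwards [hfh] with p hp
  rw [hp, expCorrection]

variable [IsProbabilityMeasure P]

lemma exists_isCompensatedIntegral_mul_gam (hL : IsPoissonJumpProcess P T υ L) (hT : 0 ≤ T)
    (hh : ContinuousOn h (Set.Icc 0 T)) :
    ∃ I, IsCompensatedIntegral P (fun ω => jumpMeasure T (fun t => L t ω)) (compensator T υ)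
      (fun p => h p.1 * gam p.2) I :=
  hL.poisson.exists_isCompensatedIntegral
    (fun n => compensator_bigJumps_lt_top hL.levyMeasure n)
    (ae_compensator_snd_ne_zero hL.levyMeasure) (hL.memLp_mul_gam hT hh)

lemma memLp_of_isExponential (hL : IsPoissonJumpProcess P T υ L) (hT : 0 < T)
    (hh : ContinuousOn h (Set.Icc 0 T)) {Y : Ω → ℝ} (hY : IsExponential P T υ L h Y) :
    MemLp Y 2 P ∧ AEStronglyMeasurable[sigmaL T L] Y P := by
  obtain ⟨I, hI, hYI⟩ := hY
  obtain ⟨f, C, hf, hC, hfh⟩ := hL.exists_continuous_bounded_ae_eq hT.le hh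
  have hI' := hI.congr_left hL.poisson (g := fun p => f p.1 * gam p.2)
    (hfh.mono fun p hp => by simp only [hp])
  have hIm := hL.aestronglyMeasurable_mul_gam hT hf hC hI'
  have hI2 := hI'.memLp_exp hL.poisson (fun n => compensator_bigJumps_lt_top hL.levyMeasure n)
    ((hf.measurable.comp measurable_fst).mul (continuous_gam.measurable.comp measurable_snd))
    (memLp_compensator_gam hL.levyMeasure hf hC) (abs_mul_gam_le hC)
  constructor
  · refine (memLp_congr_ae hYI).2 ?_
    simp only [Real.exp_sub, div_eq_mul_inv]
    exact hI2.mul_const _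
  · exact AEStronglyMeasurable.congr
      (Real.continuous_exp.comp_aestronglyMeasurable (hIm.sub aestronglyMeasurable_const)) hYI.symm

/-- A random variable in `L²(F_T, P)` that is orthogonal to all exponentials vanishes. -/
lemma eq_zero_of_forall_integral_mul_eq_zero (hL : IsPoissonJumpProcess P T υ L) (hT : 0 < T)
    {X : Lp ℝ 2 P} (hX : AEStronglyMeasurable[sigmaL T L] X P)
    (hzero : ∀ h : ℝ → ℝ, ContinuousOn h (Set.Icc 0 T) → ∀ Y : Ω → ℝ,
      IsExponential P T υ L h Y → ∫ ω, X ω * Y ω ∂P = 0) : X = 0 := by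
  have hfin := fun n => compensator_bigJumps_lt_top (T := T) hL.levyMeasure n
  choose I hI using fun f : {f : ℝ → ℝ // Continuous f} =>
    hL.exists_isCompensatedIntegral_mul_gam hT.le f.2.continuousOn
  -- Strictly measurable versions are taken, so that the σ-algebra generated by the whole family
  -- lies in `m0`.
  let J : {f : ℝ → ℝ // Continuous f} → Ω → ℝ := fun f => (hI f).memLp.1.mk
  have hJm (f) : Measurable (J f) := (hI f).memLp.1.stronglyMeasurable_mk.measurable
  have hJ (f) := (hI f).congr_right (hI f).memLp.1.ae_eq_mk
  have hJpi : Measurable fun ω f => J f ω := measurable_pi_iff.2 hJm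
  have hX2 := Lp.memLp X
  have hexp (s : Finset {f : ℝ → ℝ // Continuous f}) (c : {f : ℝ → ℝ // Continuous f} → ℝ) :
      Integrable (fun ω => X ω * Real.exp (∑ i ∈ s, c i * J i ω)) P ∧
        ∫ ω, X ω * Real.exp (∑ i ∈ s, c i * J i ω) ∂P = 0 := by
    set h : ℝ → ℝ := fun t => ∑ i ∈ s, c i * i.1 t with hh
    have hc : Continuous h :=
      continuous_finsetSum _ fun i _ => continuous_const.mul i.2
    set K := ∫ p, expCorrection h p ∂(compensator T υ) with hK
    have hsum := IsCompensatedIntegral.finset_sum hL.poisson hfin s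
      (F := fun i p => c i * (i.1 p.1 * gam p.2)) (X := fun i ω => c i * J i ω)
      (fun i _ => (hL.memLp_mul_gam hT.le i.2.continuousOn).const_mul (c i))
      fun i _ => (hJ i).const_mul (c i)
    -- By linearity the combination is an integral of h(t)γ(z) with h = ∑ c i • i. The normalising
    -- factor exp(K) is deterministic and does not affect orthogonality.
    have hY : IsExponential P T υ L h fun ω => Real.exp (∑ i ∈ s, c i * J i ω - K) := by
      refine ⟨_, ?_, ae_eq_refl _⟩
      convert hsum using 2 with p
      simp only [hh, Finset.sum_mul, mul_assoc]
    have e (ω) : X ω * Real.exp (∑ i ∈ s, c i * J i ω) =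
        X ω * Real.exp (∑ i ∈ s, c i * J i ω - K) * Real.exp K := by
      rw [mul_assoc, ← Real.exp_add, sub_add_cancel]
    simp only [e]
    refine ⟨(hX2.integrable_mul (hL.memLp_of_isExponential hT hc.continuousOn hY).1).mul_const _, ?_⟩
    rw [integral_mul_const, hzero h hc.continuousOn _ hY, zero_mul]
  have hGm : MeasurableSpace.comap (fun ω f => J f ω) inferInstance ≤ m0 := hJpi.comap_le
  -- Each L_t is a.s. equal to a function of the family J, so the σ-algebra of L lies in that of J
  -- up to null sets.
  have hLG : sigmaL T L ≤ eventuallyMeasurableSpace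
      (MeasurableSpace.comap (fun ω f => J f ω) inferInstance) (ae P) := by
    refine iSup₂_le fun t ht => ?_
    have hLt : AEStronglyMeasurable[MeasurableSpace.comap (fun ω f => J f ω) inferInstance]
        (L t) P := by
      refine hL.aestronglyMeasurable_of_mul_gam hGm (fun f hf => ⟨J ⟨f, hf⟩, hJ ⟨f, hf⟩, ?_⟩) ht
      exact ((measurable_pi_apply (⟨f, hf⟩ : {f : ℝ → ℝ // Continuous f})).comp
        (comap_measurable fun ω f => J f ω)).aestronglyMeasurable
    rintro _ ⟨B, hB, rfl⟩
    exact EventuallyMeasurable.congr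
      hLt.stronglyMeasurable_mk.measurable.eventuallyMeasurable hLt.ae_eq_mk hB
  refine Lp.eq_zero_iff_ae_eq_zero.2 (Lp.ae_eq_zero_of_forall_setIntegral_eq_zero' ℝ hGm X
    two_ne_zero ENNReal.ofNat_ne_top (fun s _ _ => (hX2.integrable one_le_two).integrableOn)
    (fun s hs _ => setIntegral_eq_zero_of_forall_integral_mul_exp_eq_zero hJm
      (hX2.integrable one_le_two) (fun s c => (hexp s c).1) (fun s c => (hexp s c).2) hs)
    (aestronglyMeasurable_of_le_eventuallyMeasurableSpace hLG hX))

end IsPoissonJumpProcess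

end PoissonJump

/-! ### The theorem -/

theorem mainTheorem10 {Ω : Type*} [MeasurableSpace Ω] (P : Measure Ω) [IsProbabilityMeasure P]
    (T : ℝ) (hT : 0 < T) (υ : Measure ℝ) (L : ℝ → Ω → ℝ)
    (hL : PoissonJump.IsPoissonJumpProcess P T υ L) :
    (∀ h : ℝ → ℝ, ContinuousOn h (Set.Icc 0 T) →
      Integrable (PoissonJump.expCorrection h) (PoissonJump.compensator T υ) ∧
      (∃ Y : Ω → ℝ, PoissonJump.IsExponential P T υ L h Y) ∧
      ∀ Y : Ω → ℝ, PoissonJump.IsExponential P T υ L h Y → MemLp Y 2 P) ∧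
    (Submodule.span ℝ {Y : Lp ℝ 2 P | ∃ h : ℝ → ℝ, ContinuousOn h (Set.Icc 0 T) ∧
      PoissonJump.IsExponential P T υ L h Y}).topologicalClosure = PoissonJump.L2FT P T L := by
  refine ⟨fun h hh => ⟨hL.integrable_expCorrection hT.le hh, ?_,
    fun Y hY => (hL.memLp_of_isExponential hT hh hY).1⟩, ?_⟩
  · obtain ⟨I, hI⟩ := hL.exists_isCompensatedIntegral_mul_gam hT.le hh
    exact ⟨_, I, hI, ae_eq_refl _⟩
  set S := {Y : Lp ℝ 2 P | ∃ h : ℝ → ℝ, ContinuousOn h (Set.Icc 0 T) ∧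
    PoissonJump.IsExponential P T υ L h Y} with hS
  have hle : (Submodule.span ℝ S).topologicalClosure ≤ PoissonJump.L2FT P T L := by
    refine Submodule.topologicalClosure_minimal _ (Submodule.span_le.2 ?_)
      (isClosed_aestronglyMeasurable hL.sigmaL_le)
    rintro Y ⟨h, hh, hY⟩
    exact mem_lpMeas_iff_aestronglyMeasurable.2 (hL.memLp_of_isExponential hT hh hY).2
  refine le_antisymm hle fun X hX => ?_
  have : CompleteSpace (Submodule.span ℝ S).topologicalClosure :=
    (Submodule.isClosed_topologicalClosure _).completeSpace_coe
  obtain ⟨p, hp, q, hq, rfl⟩ :=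
    Submodule.exists_add_mem_mem_orthogonal (K := (Submodule.span ℝ S).topologicalClosure) X
  -- The orthogonal component q of X stays in `L2FT`, since both X and its projection lie there.
  have hqX : q ∈ PoissonJump.L2FT P T L := by
    simpa using Submodule.sub_mem _ hX (hle hp)
  have hq0 : q = 0 := by
    refine hL.eq_zero_of_forall_integral_mul_eq_zero hT
      (mem_lpMeas_iff_aestronglyMeasurable.1 hqX) fun h hh Y hY => ?_
    have hY2 := (hL.memLp_of_isExponential hT hh hY).1
    have hYS : hY2.toLp Y ∈ S := by
      obtain ⟨I, hI, hYI⟩ := hY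
      exact ⟨h, hh, I, hI, hY2.coeFn_toLp.trans hYI⟩
    have := (Submodule.mem_orthogonal _ _).1 hq _
      (Submodule.le_topologicalClosure _ (Submodule.subset_span hYS))
    rw [L2.inner_def] at this
    rw [← this]
    refine integral_congr_ae ?_
    filter_upwards [hY2.coeFn_toLp] with ω hω
    simp [hω]
  rwa [hq0, add_zero]
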